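/- For integers $2\le s<t$ and $n\ge 1$, let $$f_{s,t}(n)=\min_{G}\ \max\{|W| : W\subseteq V(G)\ \text{and}\ G[W]\ \text{contains no}\ K_s\},$$ where the minimum is taken over all $K_t$-free graphs $G$ of order $n$. Then for every integer $s\ge 4$ there are a constant $c=c(s)>0$ and an integer $n_0=n_0(s)$ such that $$\frac{f_{s+1,s+2}(n)}{f_{s,s+2}(n)}\ \ge\ c\,\sqrt{\frac{\log n}{\log\log n}}\qquad\text{for all } n\ge n_0,$$ and consequently $$\lim_{n\to\infty}\frac{f_{s+1,s+2}(n)}{f_{s,s+2}(n)}=\infty .$$ -/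

import Mathlib

open Filter

/-- A set `W` of vertices is `s`-independent in `G` if the induced subgraph `G[W]` contains no
copy of the complete graph on `s` vertices. -/
def SIndependent {V : Type*} (G : SimpleGraph V) (s : ℕ) (W : Finset V) : Prop :=
  (G.induce (W : Set V)).CliqueFree s

/-- The `s`-independence number `α_s(G)`: the largest size of an `s`-independent set. -/
noncomputable def sIndepNum {V : Type*} (G : SimpleGraph V) (s : ℕ) : ℕ :=
  sSup {k : ℕ | ∃ W : Finset V, SIndependent G s W ∧ W.card = k}

/-- The Erdős–Rogers function `f_{s,t}(n)`: the minimum of `α_s(G)` over all `K_t`-free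
graphs `G` of order `n`. -/
noncomputable def erdosRogers (s t n : ℕ) : ℕ :=
  sInf {k : ℕ | ∃ G : SimpleGraph (Fin n), G.CliqueFree t ∧ sIndepNum G s = k}

/-- For a finite graph and `s ≥ 1` the supremum defining `α_s(G)` is a maximum. -/
theorem sIndepNum_isGreatest {V : Type*} [Fintype V] (G : SimpleGraph V) (s : ℕ) (hs : 1 ≤ s) :
    IsGreatest {k : ℕ | ∃ W : Finset V, SIndependent G s W ∧ W.card = k} (sIndepNum G s) := by
  have hb : BddAbove {k : ℕ | ∃ W : Finset V, SIndependent G s W ∧ W.card = k} :=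
    ⟨Fintype.card V, by rintro k ⟨W, -, rfl⟩; exact W.card_le_univ⟩
  refine ⟨Nat.sSup_mem ⟨0, ∅, ?_, rfl⟩ hb, fun k hk => le_csSup hb hk⟩
  unfold SIndependent
  have : IsEmpty ((∅ : Finset V) : Set V) := by simp
  exact SimpleGraph.cliqueFree_of_card_lt (by rw [Fintype.card_eq_zero]; omega)

/-- For `t ≥ 2` there is a `K_t`-free graph of every order, so the infimum defining
`f_{s,t}(n)` is a minimum. -/
theorem erdosRogers_isLeast (s t n : ℕ) (ht : 2 ≤ t) :
    IsLeast {k : ℕ | ∃ G : SimpleGraph (Fin n), G.CliqueFree t ∧ sIndepNum G s = k}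
      (erdosRogers s t n) :=
  ⟨Nat.sInf_mem ⟨_, ⊥, SimpleGraph.cliqueFree_bot ht, rfl⟩, fun _ hk => Nat.sInf_le hk⟩

/-! The ratio diverges because f_{s+1,s+2}(n) is at least of order √(n log n / log log n), while
f_{s,s+2}(n) is at most of order √n.

Lower bound (`exists_le_erdosRogers_succ`): put D = √(n log n / log log n). In a K_{s+2}-free graph
neighbourhoods are K_{s+1}-free, so a vertex of degree above D suffices. If all degrees are at most
D, Shearer's averaging over all independent sets (`exists_isIndepSet_of_degree_le`) yields one of
order (n/D) · log n / log log n, which is D up to a constant.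

Upper bound (`exists_erdosRogers_le`): in the affine plane over a field of q elements, q of order
√n, keep each non-vertical line with probability 1/M, where M is of order q / log q, and place on
each kept line a random complete s-partite graph. A clique of size s + 2 ≥ 6 has at most s points on
any line, so it contains one of three small configurations (`exists_configuration`). Each of these
spans so many lines relative to its degrees of freedom that only about q · polylog(q) = o(q²) of
them survive, and deleting one vertex from each destroys every K_{s+2}. On the other hand, a set of
2sq points meets at least half of the lines in s or more points (`half_le_card_rich_lines`). It
fails to contain K_s with probability exp(-Ω(q log q)), with a constant that beats the union bound
over all such sets. -/

/-! ### Independent sets in sparse graphs with bounded clique number. -/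

/-- Ramsey-type bound: a vertex set without cliques of size `m + 1` all of whose independent subsets
have at most `a` elements has fewer than `(1 + a) ^ m` elements. -/
theorem card_succ_le_pow_of_cliqueFreeOn {V : Type*} (G : SimpleGraph V) (a : ℕ) (m : ℕ) :
    ∀ X : Finset V, G.CliqueFreeOn (X : Set V) (m + 1) →
      (∀ A ⊆ X, G.IsIndepSet (A : Set V) → A.card ≤ a) → X.card + 1 ≤ (1 + a) ^ m := by
  classical
  induction m with
  | zero =>
    intro X hX _
    have : X = ∅ := by
      rw [Finset.eq_empty_iff_forall_notMem]
      intro x hx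
      refine hX (t := {x}) (by simpa using hx) ?_
      simp [SimpleGraph.isNClique_iff]
    simp [this]
  | succ m ih =>
    intro X hX ha
    obtain ⟨I, hI, hmax⟩ := (X.powerset.filter fun A : Finset V => G.IsIndepSet (A : Set V)).exists_max_image
      Finset.card ⟨∅, by simp [SimpleGraph.IsIndepSet]⟩
    simp only [Finset.mem_filter, Finset.mem_powerset] at hI hmax
    -- A maximum independent set dominates: `X` is covered by the closed neighbourhoods of the
    -- points of `I`.
    have hcov : X ⊆ I.biUnion fun u => insert u (X.filter fun w => G.Adj u w) := by
      intro x hx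
      by_contra hcon
      simp only [Finset.mem_biUnion, Finset.mem_insert, Finset.mem_filter, not_exists, not_and,
        not_or] at hcon
      have hxI : x ∉ I := fun h => (hcon x h).1 rfl
      have h1 := hmax (insert x I) ⟨Finset.insert_subset hx hI.1, by
        have := hI.2
        unfold SimpleGraph.IsIndepSet at this ⊢
        rw [Finset.coe_insert, Set.pairwise_insert]
        exact ⟨this, fun u hu _ => ⟨fun h => (hcon u hu).2 hx h.symm, (hcon u hu).2 hx⟩⟩⟩
      rw [Finset.card_insert_of_notMem hxI] at h1
      omega
    -- The neighbourhood of `u` in `X` has smaller clique number; the `+ 1` in the induction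
    -- hypothesis pays for `u` itself.
    have hdeg : ∀ u ∈ I, (insert u (X.filter fun w => G.Adj u w)).card ≤ (1 + a) ^ m := by
      intro u hu
      refine (Finset.card_insert_le _ _).trans (ih _ ?_ fun A hA => ha A fun x hx =>
        (Finset.mem_filter.1 (hA hx)).1)
      intro t ht htc
      have ht' : ∀ x ∈ t, x ∈ X ∧ G.Adj u x := fun x hx => by simpa using ht hx
      refine hX (t := insert u t) ?_ (htc.insert fun b hb => (ht' b hb).2)
      intro x hx
      simp only [Finset.coe_insert, Set.mem_insert_iff, Finset.mem_coe] at hx ⊢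
      rcases hx with rfl | hx
      · exact hI.1 hu
      · exact (ht' x hx).1
    have h1 := (Finset.card_le_card hcov).trans (Finset.card_biUnion_le_card_mul _ _ _ hdeg)
    have h2 := Nat.mul_le_mul_right ((1 + a) ^ m) (ha I hI.1 hI.2)
    have h3 : 1 ≤ (1 + a) ^ m := Nat.one_le_pow _ _ (by omega)
    rw [pow_succ]
    nlinarith

theorem card_filter_card_le_pow {V : Type*} [DecidableEq V] (X : Finset V) (j : ℕ) :
    (X.powerset.filter fun A => A.card ≤ j).card ≤ (X.card + 1) ^ j := by
  induction j with
  | zero =>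
    have : (X.powerset.filter fun A => A.card ≤ 0) ⊆ {∅} := by
      intro A; simp
    simpa using Finset.card_le_card this
  | succ j ih =>
    have hsub : (X.powerset.filter fun A => A.card ≤ j + 1) ⊆
        (X.powerset.filter fun A => A.card ≤ j) ∪
        (X ×ˢ (X.powerset.filter fun A => A.card ≤ j)).image fun p => insert p.1 p.2 := by
      intro A hA
      simp only [Finset.mem_filter, Finset.mem_powerset, Finset.mem_union, Finset.mem_image,
        Finset.mem_product, Prod.exists] at hA ⊢
      by_cases h : A.card ≤ j
      · exact Or.inl ⟨hA.1, h⟩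
      · obtain ⟨x, hx⟩ := Finset.card_pos.1 (by omega : 0 < A.card)
        refine Or.inr ⟨x, A.erase x, ⟨hA.1 hx, (Finset.erase_subset _ _).trans hA.1, ?_⟩,
          Finset.insert_erase hx⟩
        rw [Finset.card_erase_of_mem hx]; omega
    have h1 := (Finset.card_le_card hsub).trans (Finset.card_union_le _ _)
    have h2 : ((X ×ˢ (X.powerset.filter fun A => A.card ≤ j)).image fun p => insert p.1 p.2).card ≤
      X.card * (X.powerset.filter fun A => A.card ≤ j).card :=
      Finset.card_image_le.trans (Finset.card_product _ _).le
    calc _ ≤ (X.card + 1) * (X.powerset.filter fun A => A.card ≤ j).card := by linarith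
      _ ≤ _ := by rw [pow_succ, mul_comm]; exact Nat.mul_le_mul_right _ ih

open Classical in
/-- The independent subsets of a finite vertex set. -/
noncomputable def indepSubsets {V : Type*} (G : SimpleGraph V) (X : Finset V) :
    Finset (Finset V) :=
  X.powerset.filter fun A => G.IsIndepSet (A : Set V)

theorem mem_indepSubsets {V : Type*} {G : SimpleGraph V} {X A : Finset V} :
    A ∈ indepSubsets G X ↔ A ⊆ X ∧ G.IsIndepSet (A : Set V) := by
  simp [indepSubsets]

theorem two_pow_le_card_indepSubsets {V : Type*} {G : SimpleGraph V} {X A : Finset V}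
    (hA : A ∈ indepSubsets G X) : 2 ^ A.card ≤ (indepSubsets G X).card := by
  rw [mem_indepSubsets] at hA
  rw [← Finset.card_powerset]
  refine Finset.card_le_card fun B hB => ?_
  rw [Finset.mem_powerset] at hB
  exact mem_indepSubsets.2 ⟨hB.trans hA.1, hA.2.mono (by exact_mod_cast hB)⟩

/-- In a set without large cliques, independent subsets are large on average unless there are
few of them. -/
theorem le_add_sum_card_indepSubsets {V : Type*} (G : SimpleGraph V) (X : Finset V) (s j : ℕ)
    (D β : ℝ) (hD₀ : 0 ≤ D) (hX : G.CliqueFreeOn (X : Set V) (s + 1)) (hj : 4 * β ≤ j + 1)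
    (hnum : ∀ a i : ℕ, 2 ^ a ≤ i → D < β * (1 + i) → 2 * (1 + a) ^ (s * j) ≤ i) :
    β * (1 + (indepSubsets G X).card) ≤ D + ∑ A ∈ indepSubsets G X, (A.card : ℝ) := by
  classical
  have hS : 0 ≤ ∑ A ∈ indepSubsets G X, (A.card : ℝ) := Finset.sum_nonneg fun _ _ => by positivity
  -- Few independent subsets: `D` alone suffices. Otherwise their number is large enough for `hnum`
  -- to apply.
  by_cases hD : β * (1 + (indepSubsets G X).card) ≤ D
  · linarith
  push Not at hD
  set F := indepSubsets G X with hF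
  have h0 : (∅ : Finset V) ∈ F := by simp [hF, mem_indepSubsets, SimpleGraph.IsIndepSet]
  obtain ⟨I, hI, hmax⟩ := F.exists_max_image Finset.card ⟨∅, h0⟩
  have hr : X.card + 1 ≤ (1 + I.card) ^ s := card_succ_le_pow_of_cliqueFreeOn G I.card s X hX
    fun A hA hA' => hmax A (mem_indepSubsets.2 ⟨hA, hA'⟩)
  have h2 := hnum I.card F.card (two_pow_le_card_indepSubsets hI) hD
  -- By the Ramsey bound `X` is polynomially small in the size of `I`, so sets of size at most `j`
  -- are at most half of `F`. The other half have at least `j + 1 ≥ 4 * β` elements each.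
  have hsmall : (F.filter fun A => A.card ≤ j).card ≤ (1 + I.card) ^ (s * j) := by
    calc (F.filter fun A => A.card ≤ j).card ≤ (X.powerset.filter fun A => A.card ≤ j).card :=
          Finset.card_le_card (Finset.filter_subset_filter _ (Finset.filter_subset _ _))
      _ ≤ (X.card + 1) ^ j := card_filter_card_le_pow X j
      _ ≤ _ := by rw [pow_mul]; exact Nat.pow_le_pow_left hr j
  have hcard := Finset.card_filter_add_card_filter_not (s := F) (fun A => A.card ≤ j)
  have hbig : F.card ≤ 2 * (F.filter fun A => ¬ A.card ≤ j).card := by omega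
  have hF1 : 1 ≤ F.card := Finset.card_pos.2 ⟨∅, h0⟩
  have h3 : ((F.filter fun A => ¬ A.card ≤ j).card : ℝ) * (j + 1) ≤ ∑ A ∈ F, (A.card : ℝ) := by
    rw [← nsmul_eq_mul]
    refine (Finset.card_nsmul_le_sum _ (fun A => (A.card : ℝ)) _ fun A hA => ?_).trans
      (Finset.sum_le_sum_of_subset_of_nonneg (Finset.filter_subset _ _) fun _ _ _ => by positivity)
    have := (Finset.mem_filter.1 hA).2
    exact_mod_cast (by omega : j + 1 ≤ A.card)
  have hbig' : (F.card : ℝ) ≤ 2 * (F.filter fun A => ¬ A.card ≤ j).card := by exact_mod_cast hbig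
  have hF1' : (1 : ℝ) ≤ F.card := by exact_mod_cast hF1
  have hj0 : (0 : ℝ) ≤ (j : ℝ) + 1 := by positivity
  have h4 : (F.card : ℝ) * (j + 1) ≤ 2 * ∑ A ∈ F, (A.card : ℝ) := by nlinarith
  have h5 : (F.card : ℝ) * (4 * β) ≤ F.card * (j + 1) := by gcongr
  have h6 : β * (1 + F.card) ≤ ∑ A ∈ F, (A.card : ℝ) := by nlinarith
  linarith

/-- A graph of maximum degree at most `D` without cliques of size `s + 2` has a large independent
set; `β` is the gain over the trivial bound. -/
theorem exists_isIndepSet_of_degree_le {V : Type*} [Fintype V] (G : SimpleGraph V) (s j : ℕ)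
    (D β : ℝ) (hD₀ : 0 ≤ D) (hG : G.CliqueFree (s + 2))
    (hdeg : ∀ v, ((G.neighborSet v).ncard : ℝ) ≤ D) (hj : 4 * β ≤ j + 1)
    (hnum : ∀ a i : ℕ, 2 ^ a ≤ i → D < β * (1 + i) → 2 * (1 + a) ^ (s * j) ≤ i) :
    ∃ W : Finset V, G.IsIndepSet (W : Set V) ∧ Fintype.card V * β ≤ 2 * D * W.card := by
  classical
  set F := indepSubsets G Finset.univ with hF
  have memF : ∀ W, W ∈ F ↔ G.IsIndepSet (W : Set V) := fun W => by simp [hF, mem_indepSubsets]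
  have hF0 : (∅ : Finset V) ∈ F := by simp [memF, SimpleGraph.IsIndepSet]
  have hdeg' : ∀ v, (G.degree v : ℝ) ≤ D := fun v => by
    have := hdeg v
    rwa [Set.ncard_eq_toFinset_card', ← SimpleGraph.neighborFinset, SimpleGraph.card_neighborFinset_eq_degree] at this
  -- For a uniformly random independent set `W`, the expectation of D · 1[v ∈ W] + |W ∩ N(v)| is at
  -- least β. This is proved conditionally on the part of `W` outside the closed neighbourhood of
  -- `v`.
  have key : ∀ v, β * F.card ≤
      ∑ W ∈ F, (D * (if v ∈ W then 1 else 0) + ((W ∩ G.neighborFinset v).card : ℝ)) := by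
    intro v
    set N := insert v (G.neighborFinset v) with hN
    set φ : Finset V → Finset V := fun W => W \ N with hφ
    have hmaps : ∀ W ∈ F, φ W ∈ F.image φ := fun W hW => Finset.mem_image_of_mem φ hW
    rw [Finset.card_eq_sum_card_fiberwise hmaps, ← Finset.sum_fiberwise_of_maps_to hmaps]
    push_cast
    rw [Finset.mul_sum]
    refine Finset.sum_le_sum fun W' hW' => ?_
    obtain ⟨W₀, hW₀, rfl⟩ := Finset.mem_image.1 hW'
    set U := φ W₀ with hU
    have hUN : Disjoint U N := Finset.sdiff_disjoint
    have hUi : G.IsIndepSet (U : Set V) :=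
      ((memF _).1 hW₀).mono (by exact_mod_cast Finset.sdiff_subset)
    have hvU : v ∉ U := fun h => Finset.disjoint_left.1 hUN h (Finset.mem_insert_self _ _)
    have hUadj : ∀ u ∈ U, ¬ G.Adj v u := fun u hu h =>
      Finset.disjoint_left.1 hUN hu (Finset.mem_insert_of_mem (by simpa using h))
    set X := (G.neighborFinset v).filter fun x => ∀ u ∈ U, ¬ G.Adj x u with hX
    have hXN : X ⊆ G.neighborFinset v := Finset.filter_subset _ _
    have hXU : Disjoint U X := hUN.mono_right (hXN.trans (Finset.subset_insert _ _))
    have hvX : v ∉ X := fun h => by simpa using hXN h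
    -- Given the outer part `U`, either `W` adds `v` alone, or it adds an independent set of
    -- neighbours of `v` that have no neighbour in `U`.
    have hfib : F.filter (fun W => φ W = U) =
        insert (insert v U) ((indepSubsets G X).image fun A => U ∪ A) := by
      ext W
      simp only [Finset.mem_filter, Finset.mem_insert, Finset.mem_image, memF, mem_indepSubsets]
      constructor
      · rintro ⟨hWi, hW⟩
        by_cases hv : v ∈ W
        · left
          ext x
          have hx : x ∈ U ↔ x ∈ W ∧ x ∉ N := by rw [← hW]; simp [hφ]
          rw [Finset.mem_insert, hx, hN, Finset.mem_insert, SimpleGraph.mem_neighborFinset]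
          constructor
          · intro hxW
            by_cases hxv : x = v
            · exact Or.inl hxv
            · exact Or.inr ⟨hxW, by
                rintro (h | h)
                · exact hxv h
                · exact hWi hv hxW (Ne.symm hxv) h⟩
          · rintro (rfl | h)
            · exact hv
            · exact h.1
        · right
          refine ⟨W ∩ G.neighborFinset v, ⟨?_, hWi.mono (by exact_mod_cast Finset.inter_subset_left)⟩, ?_⟩
          · intro x hx
            rw [Finset.mem_inter] at hx
            refine Finset.mem_filter.2 ⟨hx.2, fun u hu h => ?_⟩
            have huW : u ∈ W := by rw [← hW] at hu; exact (Finset.mem_sdiff.1 hu).1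
            exact hWi hx.1 huW h.ne h
          · ext x
            have hx : x ∈ U ↔ x ∈ W ∧ x ∉ N := by rw [← hW]; simp [hφ]
            rw [Finset.mem_union, hx, hN, Finset.mem_insert, Finset.mem_inter]
            by_cases hxv : x = v
            · subst hxv; simp [hv]
            · tauto
      · rintro (rfl | ⟨A, ⟨hAX, hAi⟩, rfl⟩)
        · constructor
          · unfold SimpleGraph.IsIndepSet at hUi ⊢
            rw [Finset.coe_insert, Set.pairwise_insert]
            exact ⟨hUi, fun u hu _ => ⟨hUadj u hu, fun h => hUadj u hu h.symm⟩⟩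
          · simp only [hφ]
            rw [Finset.insert_sdiff_of_mem _ (Finset.mem_insert_self _ _),
              Finset.sdiff_eq_self_of_disjoint hUN]
        · constructor
          · unfold SimpleGraph.IsIndepSet at hUi hAi ⊢
            rw [Finset.coe_union, Set.pairwise_union]
            refine ⟨hUi, hAi, fun u hu x hx _ => ?_⟩
            have := (Finset.mem_filter.1 (hAX hx)).2 u hu
            exact ⟨fun h => this h.symm, this⟩
          · simp only [hφ]
            rw [Finset.union_sdiff_distrib, Finset.sdiff_eq_self_of_disjoint hUN,
              Finset.sdiff_eq_empty_iff_subset.2, Finset.union_empty]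
            exact hAX.trans (hXN.trans (Finset.subset_insert _ _))
    have hinj : Set.InjOn (fun A => U ∪ A) (indepSubsets G X : Set (Finset V)) := by
      intro A hA B hB hAB
      have hA' := (mem_indepSubsets.1 hA).1
      have hB' := (mem_indepSubsets.1 hB).1
      simp only at hAB
      rw [← Finset.union_sdiff_cancel_left (hXU.mono_right hA'), hAB,
        Finset.union_sdiff_cancel_left (hXU.mono_right hB')]
    have hnot : insert v U ∉ (indepSubsets G X).image fun A => U ∪ A := by
      intro h
      obtain ⟨A, hA, hAe⟩ := Finset.mem_image.1 h
      have : v ∈ U ∪ A := by rw [show U ∪ A = insert v U from hAe]; exact Finset.mem_insert_self _ _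
      rcases Finset.mem_union.1 this with h | h
      · exact hvU h
      · exact hvX ((mem_indepSubsets.1 hA).1 h)
    rw [hfib, Finset.card_insert_of_notMem hnot, Finset.sum_insert hnot,
      Finset.card_image_of_injOn hinj, Finset.sum_image hinj]
    have hXfree : G.CliqueFreeOn (X : Set V) (s + 1) := by
      have h1 : G.CliqueFreeOn (Set.univ) (s + 1 + 1) := hG.cliqueFreeOn
      refine SimpleGraph.CliqueFreeOn.subset G ?_ (SimpleGraph.CliqueFreeOn.of_succ G h1 (Set.mem_univ v))
      intro x hx
      exact ⟨trivial, by simpa using hXN hx⟩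
    have hloc := le_add_sum_card_indepSubsets G X s j D β hD₀ hXfree hj hnum
    have hsum : ∑ A ∈ indepSubsets G X, (A.card : ℝ) ≤ ∑ A ∈ indepSubsets G X,
        (D * (if v ∈ U ∪ A then 1 else 0) + (((U ∪ A) ∩ G.neighborFinset v).card : ℝ)) := by
      refine Finset.sum_le_sum fun A hA => ?_
      have hA' := (mem_indepSubsets.1 hA).1
      have h1 : (A.card : ℝ) ≤ (((U ∪ A) ∩ G.neighborFinset v).card : ℝ) := by
        exact_mod_cast Finset.card_le_card
          (Finset.subset_inter Finset.subset_union_right (hA'.trans hXN))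
      have h2 : 0 ≤ D * (if v ∈ U ∪ A then (1 : ℝ) else 0) := by
        split_ifs <;> simp [hD₀]
      linarith
    have hv1 : (if v ∈ insert v U then (1 : ℝ) else 0) = 1 := by simp
    rw [hv1]
    push_cast
    have h0 : (0 : ℝ) ≤ ((insert v U ∩ G.neighborFinset v).card : ℝ) := by positivity
    linarith
  -- Summed over `v`, each `w ∈ W` contributes `D` for itself and its degree, at most `D`, for its
  -- neighbours.
  have hsum : ∑ v : V, ∑ W ∈ F,
      (D * (if v ∈ W then 1 else 0) + ((W ∩ G.neighborFinset v).card : ℝ)) ≤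
      ∑ W ∈ F, 2 * D * (W.card : ℝ) := by
    rw [Finset.sum_comm]
    refine Finset.sum_le_sum fun W _ => ?_
    rw [Finset.sum_add_distrib, ← Finset.mul_sum]
    have h1 : ∑ v : V, (if v ∈ W then (1 : ℝ) else 0) = W.card := by simp
    have h2 : ∑ v : V, ((W ∩ G.neighborFinset v).card : ℝ) ≤ D * W.card := by
      have : ∑ v : V, (W ∩ G.neighborFinset v).card = ∑ w ∈ W, G.degree w := by
        have h3 : ∀ v, (W ∩ G.neighborFinset v).card = ∑ w ∈ W, if G.Adj v w then 1 else 0 := by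
          intro v
          rw [← Finset.card_filter]
          congr 1
          ext w; simp
        simp_rw [h3]
        rw [Finset.sum_comm]
        refine Finset.sum_congr rfl fun w _ => ?_
        rw [← Finset.card_filter, ← SimpleGraph.card_neighborFinset_eq_degree]
        congr 1
        ext v; simp [SimpleGraph.adj_comm]
      rw [← Nat.cast_sum, this, Nat.cast_sum, mul_comm, ← nsmul_eq_mul]
      exact Finset.sum_le_card_nsmul _ _ _ fun w _ => hdeg' w
    rw [h1]; linarith
  have htot : ∑ W ∈ F, Fintype.card V * β ≤ ∑ W ∈ F, 2 * D * (W.card : ℝ) := by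
    refine le_trans ?_ hsum
    calc ∑ W ∈ F, Fintype.card V * β = ∑ v : V, β * F.card := by
          simp; ring
      _ ≤ _ := Finset.sum_le_sum fun v _ => key v
  obtain ⟨W, hW, h⟩ := Finset.exists_le_of_sum_le ⟨∅, hF0⟩ htot
  exact ⟨W, (memF W).1 hW, h⟩

/-! ### The lower bound for f_{s+1,s+2}. -/

theorem sIndependent_iff {V : Type*} {G : SimpleGraph V} {s : ℕ} {W : Finset V} :
    SIndependent G s W ↔ G.CliqueFreeOn (W : Set V) s :=
  SimpleGraph.cliqueFree_induce_iff ..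

theorem SIndependent.card_le {V : Type*} [Fintype V] {G : SimpleGraph V} {s : ℕ} (hs : 1 ≤ s)
    {W : Finset V} (h : SIndependent G s W) : W.card ≤ sIndepNum G s :=
  (sIndepNum_isGreatest G s hs).2 ⟨W, h, rfl⟩

/-- This is the hypothesis `hnum` of the averaging argument for the actual parameters. The lower
bound on `i` makes log i at least a quarter of log x, and `a` is at most logarithmic in `i`. Hence
log (1 + a) is of order log log i, and the exponent `s * j`, at most log x / (16 log log x), keeps
the power below a constant times √i. -/
theorem two_mul_pow_le_of_two_pow_le {s j a i : ℕ} {x β : ℝ} (hs : 1 ≤ s) (hx : 0 < x)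
    (hL : 12 ≤ Real.log x) (hLL : 1 ≤ Real.log (Real.log x))
    (hLL' : Real.log (Real.log x) + 1 ≤ Real.log x / 4) (hβ : β ≤ Real.log x)
    (hj : (j : ℝ) ≤ Real.log x / (16 * s * Real.log (Real.log x)))
    (ha : 2 ^ a ≤ i) (hi : √(x * (Real.log x / Real.log (Real.log x))) < β * (1 + i)) :
    2 * (1 + a) ^ (s * j) ≤ i := by
  set L := Real.log x with hLdef
  set M := Real.log L with hMdef
  have hs' : (1 : ℝ) ≤ s := by exact_mod_cast hs
  have hi1 : 1 ≤ i := Nat.one_le_two_pow.trans ha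
  have hi1' : (1 : ℝ) ≤ i := by exact_mod_cast hi1
  set y := Real.log i with hy
  have hLM : M ≤ L := by linarith
  have h1 : √x ≤ L * (2 * i) := by
    have h2 : √x ≤ √(x * (L / M)) := by
      apply Real.sqrt_le_sqrt
      have : 1 ≤ L / M := by rw [le_div_iff₀ (by linarith)]; linarith
      nlinarith
    have h3 : β * (1 + i) ≤ L * (2 * i) := by
      apply mul_le_mul hβ (by linarith) (by linarith) (by linarith)
    linarith
  have hlog2 := Real.log_two_lt_d9
  have hlog2' := Real.log_two_gt_d9
  have hyL : L / 4 ≤ y := by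
    have h2 := Real.log_le_log (by positivity) h1
    rw [Real.log_sqrt hx.le, Real.log_mul (by positivity) (by positivity),
      Real.log_mul (by positivity) (by positivity)] at h2
    linarith
  have hay : (a : ℝ) * Real.log 2 ≤ y := by
    have h2 : ((2 : ℝ) ^ a) ≤ i := by exact_mod_cast ha
    have := Real.log_le_log (by positivity) h2
    rwa [Real.log_pow] at this
  have ha2 : (1 + a : ℝ) ≤ y ^ 2 := by
    have : (a : ℝ) * (1 / 2) ≤ a * Real.log 2 := by gcongr; linarith
    nlinarith
  have hloga : Real.log (1 + a) ≤ 2 * Real.log y := by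
    have := Real.log_le_log (by positivity) ha2
    rwa [Real.log_pow] at this
  have he : Real.exp 1 ≤ 3 := by linarith [Real.exp_one_lt_d9]
  -- log t / t decreases only from e onwards; `hL` ensures that `L / 4 ≥ 3 > e`.
  have hanti := Real.log_div_self_antitoneOn (show Real.exp 1 ≤ L / 4 by linarith)
    (show Real.exp 1 ≤ y by linarith) hyL
  have hlogL : Real.log (L / 4) ≤ M := Real.log_le_log (by linarith) (by linarith)
  have hlogy : Real.log y * L ≤ 4 * M * y := by
    rw [div_le_div_iff₀ (by linarith) (by linarith)] at hanti
    nlinarith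
  have hsj : (s * j : ℝ) * (16 * M) ≤ L := by
    rw [le_div_iff₀ (by positivity)] at hj
    linarith
  have hfin : (s * j : ℝ) * Real.log (1 + a) ≤ y / 2 := by
    have h3 : (s * j : ℝ) * Real.log (1 + a) ≤ (s * j) * (2 * Real.log y) := by gcongr
    have h4 : (s * j : ℝ) * (16 * M) * Real.log y ≤ L * Real.log y := by
      have : 0 ≤ Real.log y := Real.log_nonneg (by linarith)
      gcongr
    have h5 : M * (16 * ((s * j : ℝ) * Real.log y)) ≤ M * (4 * y) := by linarith
    have := le_of_mul_le_mul_left h5 (by linarith)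
    linarith
  have hgoal : Real.log (2 * (1 + a) ^ (s * j)) ≤ Real.log i := by
    rw [Real.log_mul (by norm_num) (by positivity), Real.log_pow]
    push_cast
    linarith
  have := (Real.log_le_log_iff (by positivity) (by positivity)).1 hgoal
  exact_mod_cast this

theorem exists_le_erdosRogers_succ (s : ℕ) (hs : 1 ≤ s) :
    ∃ c : ℝ, 0 < c ∧ ∀ᶠ n : ℕ in atTop,
      c * √(n * (Real.log n / Real.log (Real.log n))) ≤ (erdosRogers (s + 1) (s + 2) n : ℝ) := by
  have hs' : (1 : ℝ) ≤ s := by exact_mod_cast hs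
  refine ⟨1 / (128 * s), by positivity, ?_⟩
  have hlog : Tendsto (fun n : ℕ => Real.log n) atTop atTop :=
    Real.tendsto_log_atTop.comp tendsto_natCast_atTop_atTop
  have hloglog := Real.tendsto_log_atTop.comp hlog
  have hsmall : ∀ᶠ n : ℕ in atTop, Real.log (Real.log n) + 1 ≤ Real.log n / 4 := by
    have h1 : ∀ᶠ y : ℝ in atTop, ‖Real.log y‖ ≤ 1 / 8 * ‖id y‖ :=
      Real.isLittleO_log_id_atTop.bound (by norm_num)
    have h2 : ∀ᶠ y : ℝ in atTop, Real.log y + 1 ≤ y / 4 := by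
      filter_upwards [h1, eventually_ge_atTop 8] with y hy hy8
      simp only [Real.norm_eq_abs, id] at hy
      rw [abs_of_nonneg (by linarith : (0 : ℝ) ≤ y)] at hy
      linarith [le_abs_self (Real.log y)]
    exact hlog.eventually h2
  filter_upwards [hlog.eventually_ge_atTop 12, hloglog.eventually_ge_atTop 1, hsmall,
    eventually_gt_atTop 0] with n hL hM hLM hn
  simp only [Function.comp] at hM
  have hn' : (0 : ℝ) < n := by exact_mod_cast hn
  obtain ⟨G, hG, hGe⟩ := (erdosRogers_isLeast (s + 1) (s + 2) n (by omega)).1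
  rw [← hGe]
  set L := Real.log n with hLdef
  set M := Real.log L with hMdef
  set D := √(n * (L / M)) with hD
  have hD0 : 0 < D := Real.sqrt_pos.2 (by positivity)
  have hc : 1 / (128 * (s : ℝ)) * D ≤ D := by
    have : 1 / (128 * (s : ℝ)) ≤ 1 := by rw [div_le_one (by positivity)]; linarith
    nlinarith
  by_cases hdeg : ∀ v, ((G.neighborSet v).ncard : ℝ) ≤ D
  -- Chosen so that `4 * β` equals the number whose integer part serves as `j`.
  · set β := L / (64 * s * M) with hβ
    have hβL : β ≤ L := by
      rw [hβ, div_le_iff₀ (by positivity)]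
      have : 1 ≤ 64 * s * M := by nlinarith
      nlinarith
    obtain ⟨W, hW, hWc⟩ := exists_isIndepSet_of_degree_le G s ⌊L / (16 * s * M)⌋₊ D β hD0.le hG
      hdeg (by
        have := (Nat.lt_floor_add_one (L / (16 * s * M))).le
        have h4 : 4 * β = L / (16 * s * M) := by rw [hβ]; field_simp; norm_num
        linarith)
      (fun a i ha hi => two_mul_pow_le_of_two_pow_le hs hn' hL hM hLM hβL
        (Nat.floor_le (by positivity)) ha hi)
    have hWs : SIndependent G (s + 1) W := by
      rw [sIndependent_iff]
      refine SimpleGraph.CliqueFreeOn.mono G (m := 2) (by omega) ?_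
      rw [SimpleGraph.cliqueFreeOn_two]
      exact hW
    have h1 : (W.card : ℝ) ≤ sIndepNum G (s + 1) := by exact_mod_cast hWs.card_le (by omega)
    refine le_trans ?_ h1
    rw [Fintype.card_fin] at hWc
    have hDD : D * D = n * (L / M) := Real.mul_self_sqrt (by positivity)
    -- The choice of `D` balances the two cases: `n * β` is `D ^ 2` up to a constant, so the
    -- independent set also has size of order `D`.
    have h2 : (n : ℝ) * β = D * (D / (64 * s)) := by
      rw [hβ, show D * (D / (64 * s)) = D * D / (64 * s) by ring, hDD]; field_simp
    rw [h2] at hWc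
    have h3 : D / (64 * s) ≤ 2 * W.card := le_of_mul_le_mul_left (by linarith) hD0
    have h4 : 1 / (128 * (s : ℝ)) * D = D / (64 * s) / 2 := by field_simp; norm_num
    linarith
  · push Not at hdeg
    obtain ⟨v, hv⟩ := hdeg
    classical
    have hWs : SIndependent G (s + 1) (G.neighborFinset v) := by
      rw [sIndependent_iff]
      have h1 : G.CliqueFreeOn (Set.univ) (s + 1 + 1) := hG.cliqueFreeOn
      refine SimpleGraph.CliqueFreeOn.subset G ?_
        (SimpleGraph.CliqueFreeOn.of_succ G h1 (Set.mem_univ v))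
      intro x hx
      exact ⟨trivial, by simpa using hx⟩
    have h1 : ((G.neighborFinset v).card : ℝ) ≤ sIndepNum G (s + 1) := by
      exact_mod_cast hWs.card_le (by omega)
    rw [Set.ncard_eq_toFinset_card', ← SimpleGraph.neighborFinset] at hv
    linarith

/-! ### Incidence geometry of the affine plane without vertical lines. -/

section Geometry

variable {F : Type*} [Field F]

/-- The point `v` lies on the line `y = ℓ.1 * x + ℓ.2` of the affine plane. -/
def OnLine (v ℓ : F × F) : Prop := v.2 = ℓ.1 * v.1 + ℓ.2

instance [DecidableEq F] (v ℓ : F × F) : Decidable (OnLine v ℓ) :=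
  inferInstanceAs (Decidable (_ = _))

/-- The line through two points with different first coordinates. -/
def lineThrough (v w : F × F) : F × F :=
  ((w.2 - v.2) / (w.1 - v.1), v.2 - (w.2 - v.2) / (w.1 - v.1) * v.1)

/-- This also holds when the first coordinates agree: division by zero then gives slope 0, and the
line still passes through `v`. -/
theorem onLine_lineThrough_left (v w : F × F) : OnLine v (lineThrough v w) := by
  simp [OnLine, lineThrough]

theorem onLine_lineThrough_right {v w : F × F} (h : v.1 ≠ w.1) : OnLine w (lineThrough v w) := by
  have : w.1 - v.1 ≠ 0 := sub_ne_zero.2 h.symm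
  simp only [OnLine, lineThrough]
  field_simp
  ring

theorem OnLine.fst_ne {v w ℓ : F × F} (hv : OnLine v ℓ) (hw : OnLine w ℓ) (h : v ≠ w) :
    v.1 ≠ w.1 := by
  intro h1
  refine h (Prod.ext h1 ?_)
  rw [hv, hw, h1]

theorem OnLine.line_unique {v w ℓ ℓ' : F × F} (h : v.1 ≠ w.1) (hv : OnLine v ℓ) (hw : OnLine w ℓ)
    (hv' : OnLine v ℓ') (hw' : OnLine w ℓ') : ℓ = ℓ' := by
  unfold OnLine at *
  have h1 : (ℓ.1 - ℓ'.1) * (v.1 - w.1) = 0 := by linear_combination hv' - hv - hw' + hw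
  have h2 : ℓ.1 = ℓ'.1 := by
    rcases mul_eq_zero.1 h1 with h' | h'
    · exact sub_eq_zero.1 h'
    · exact absurd (sub_eq_zero.1 h') h
  refine Prod.ext h2 ?_
  linear_combination hv' - hv - v.1 * h2

theorem OnLine.line_unique' {v w ℓ ℓ' : F × F} (h : v ≠ w) (hv : OnLine v ℓ) (hw : OnLine w ℓ)
    (hv' : OnLine v ℓ') (hw' : OnLine w ℓ') : ℓ = ℓ' :=
  OnLine.line_unique (hv.fst_ne hw h) hv hw hv' hw'

theorem OnLine.point_unique {v w ℓ ℓ' : F × F} (h : ℓ ≠ ℓ') (hv : OnLine v ℓ) (hw : OnLine w ℓ)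
    (hv' : OnLine v ℓ') (hw' : OnLine w ℓ') : v = w := by
  by_contra hne
  exact h (OnLine.line_unique (hv.fst_ne hw hne) hv hw hv' hw')

/-- Five points, no three of them collinear. -/
def IsFiveArc (v : Fin 5 → F × F) : Prop :=
  (∀ i j, i ≠ j → (v i).1 ≠ (v j).1) ∧
    ∀ i j k, i ≠ j → i ≠ k → j ≠ k → ¬ OnLine (v k) (lineThrough (v i) (v j))

/-- Three collinear points `b, c, d` and two points `e, f` off their line, such that the line
through `e` and `f` avoids `b, c, d`. -/
def IsTriplePair (b c d e f : F × F) : Prop :=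
  [b.1, c.1, d.1, e.1, f.1].Nodup ∧ OnLine d (lineThrough b c) ∧ ¬ OnLine e (lineThrough b c) ∧
    ¬ OnLine f (lineThrough b c) ∧ ¬ OnLine b (lineThrough e f) ∧ ¬ OnLine c (lineThrough e f) ∧ ¬ OnLine d (lineThrough e f)

/-- The six vertices of a complete quadrilateral with sides `abc`, `aed`, `bdf`, `cef`. -/
def IsQuadrilateral (a b c d e f : F × F) : Prop :=
  [a.1, b.1, c.1, d.1, e.1, f.1].Nodup ∧ OnLine c (lineThrough a b) ∧ OnLine c (lineThrough e f) ∧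
    OnLine d (lineThrough a e) ∧ OnLine d (lineThrough b f) ∧ ¬ OnLine d (lineThrough a b) ∧ ¬ OnLine e (lineThrough a b) ∧
    ¬ OnLine f (lineThrough a b)

variable [DecidableEq F]

/-- The lines spanned by five points. -/
def fiveArcLines (v : Fin 5 → F × F) : Finset (F × F) :=
  (Finset.univ.filter fun p : Fin 5 × Fin 5 => p.1 < p.2).image fun p => lineThrough (v p.1) (v p.2)

/-- The lines spanned by a triple and a pair. -/
def triplePairLines (b c d e f : F × F) : Finset (F × F) :=
  [lineThrough b c, lineThrough e f, lineThrough b e, lineThrough c e, lineThrough d e, lineThrough b f, lineThrough c f, lineThrough d f].toFinset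

/-- The four sides and three diagonals of a complete quadrilateral. -/
def quadrilateralLines (a b c d e f : F × F) : Finset (F × F) :=
  [lineThrough a b, lineThrough a e, lineThrough b f, lineThrough e f, lineThrough a f, lineThrough b e, lineThrough c d].toFinset

theorem IsFiveArc.card_lines {v : Fin 5 → F × F} (h : IsFiveArc v) :
    (fiveArcLines v).card = 10 := by
  unfold fiveArcLines
  rw [Finset.card_image_of_injOn]
  · decide
  · rintro ⟨i, j⟩ hij ⟨k, l⟩ hkl he
    simp only [Finset.coe_filter, Finset.mem_univ, true_and, Set.mem_ofPred_eq] at hij hkl he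
    have hk : OnLine (v k) (lineThrough (v i) (v j)) := by rw [he]; exact onLine_lineThrough_left _ _
    have hl : OnLine (v l) (lineThrough (v i) (v j)) := by
      rw [he]; exact onLine_lineThrough_right (h.1 _ _ hkl.ne)
    have hk' : i = k ∨ j = k := by
      by_contra hc; push Not at hc
      exact h.2 i j k hij.ne hc.1 hc.2 hk
    have hl' : i = l ∨ j = l := by
      by_contra hc; push Not at hc
      exact h.2 i j l hij.ne hc.1 hc.2 hl
    ext <;> grind

/-- The only geometric input is that two points lie on at most one common line, so an abstract
incidence relation suffices. If two of the lines coincided, the common line would give a forbidden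
incidence. -/
theorem nodup_of_triplePair {P Λ : Type*} {O : P → Λ → Prop}
    (hu : ∀ v w ℓ ℓ', v ≠ w → O v ℓ → O w ℓ → O v ℓ' → O w ℓ' → ℓ = ℓ') {b c d e f : P}
    {bc ef be ce de bf cf df : Λ} (nbc : b ≠ c) (nbd : b ≠ d) (ncd : c ≠ d) (nef : e ≠ f)
    (h1 : O b bc) (h2 : O c bc) (h3 : O d bc) (h4 : O e ef) (h5 : O f ef) (h6 : O b be)
    (h7 : O e be) (h8 : O c ce) (h9 : O e ce) (h10 : O d de) (h11 : O e de) (h12 : O b bf)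
    (h13 : O f bf) (h14 : O c cf) (h15 : O f cf) (h16 : O d df) (h17 : O f df)
    (i1 : ¬ O e bc) (i2 : ¬ O f bc) (i3 : ¬ O b ef) (i4 : ¬ O c ef) (i5 : ¬ O d ef) :
    [bc, ef, be, ce, de, bf, cf, df].Nodup := by
  have k1 := fun ℓ x y => hu b c bc ℓ nbc h1 h2 x y
  have k2 := fun ℓ x y => hu b d bc ℓ nbd h1 h3 x y
  have k3 := fun ℓ x y => hu c d bc ℓ ncd h2 h3 x y
  have k4 := fun ℓ x y => hu e f ef ℓ nef h4 h5 x y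
  clear hu
  simp only [List.nodup_cons, List.mem_cons, not_or, List.not_mem_nil, not_false_eq_true,
    List.nodup_nil, and_true]
  and_intros <;> intro h <;> subst h <;> grind

theorem nodup_of_quadrilateral {P Λ : Type*} {O : P → Λ → Prop}
    (hu : ∀ v w ℓ ℓ', v ≠ w → O v ℓ → O w ℓ → O v ℓ' → O w ℓ' → ℓ = ℓ') {a b c d e f : P}
    {ab ae bf ef af be cd : Λ} (nab : a ≠ b) (nac : a ≠ c) (nbc : b ≠ c) (nae : a ≠ e)
    (nad : a ≠ d) (nde : d ≠ e) (nbd : b ≠ d) (nbf : b ≠ f) (ndf : d ≠ f) (nef : e ≠ f)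
    (nce : c ≠ e) (ncf : c ≠ f)
    (h1 : O a ab) (h2 : O b ab) (h3 : O c ab) (h4 : O a ae) (h5 : O e ae) (h6 : O d ae)
    (h7 : O b bf) (h8 : O f bf) (h9 : O d bf) (h10 : O e ef) (h11 : O f ef) (h12 : O c ef)
    (h13 : O a af) (h14 : O f af) (h15 : O b be) (h16 : O e be) (h17 : O c cd) (h18 : O d cd)
    (i1 : ¬ O d ab) (i2 : ¬ O e ab) (i3 : ¬ O f ab) :
    [ab, ae, bf, ef, af, be, cd].Nodup := by
  have k1 := fun ℓ x y => hu a b ab ℓ nab h1 h2 x y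
  have k2 := fun ℓ x y => hu a c ab ℓ nac h1 h3 x y
  have k3 := fun ℓ x y => hu b c ab ℓ nbc h2 h3 x y
  have k4 := fun ℓ x y => hu a e ae ℓ nae h4 h5 x y
  have k5 := fun ℓ x y => hu a d ae ℓ nad h4 h6 x y
  have k6 := fun ℓ x y => hu d e ae ℓ nde h6 h5 x y
  have k7 := fun ℓ x y => hu b d bf ℓ nbd h7 h9 x y
  have k8 := fun ℓ x y => hu b f bf ℓ nbf h7 h8 x y
  have k9 := fun ℓ x y => hu d f bf ℓ ndf h9 h8 x y
  have k10 := fun ℓ x y => hu e f ef ℓ nef h10 h11 x y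
  have k11 := fun ℓ x y => hu c e ef ℓ nce h12 h10 x y
  have k12 := fun ℓ x y => hu c f ef ℓ ncf h12 h11 x y
  clear hu
  simp only [List.nodup_cons, List.mem_cons, not_or, List.not_mem_nil, not_false_eq_true,
    List.nodup_nil, and_true]
  and_intros <;> intro h <;> subst h <;> grind

theorem IsTriplePair.card_lines {b c d e f : F × F} (h : IsTriplePair b c d e f) :
    (triplePairLines b c d e f).card = 8 := by
  have hl := fun v w : F × F => onLine_lineThrough_left v w
  have hr := fun v w : F × F => @onLine_lineThrough_right F _ v w
  obtain ⟨hn, h1, h2, h3, h4, h5, h6⟩ := h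
  simp only [List.nodup_cons, List.mem_cons, not_or, List.not_mem_nil, not_false_eq_true,
    List.nodup_nil, and_true] at hn
  obtain ⟨⟨n1, n2, n3, n4⟩, ⟨n5, n6, n7⟩, ⟨n8, n9⟩, n10⟩ := hn
  have ne : ∀ v w : F × F, ¬ v.1 = w.1 → v ≠ w := fun v w h h' => h (by rw [h'])
  unfold triplePairLines
  rw [List.toFinset_card_of_nodup]
  · rfl
  · exact nodup_of_triplePair (fun v w ℓ ℓ' => OnLine.line_unique') (ne _ _ n1) (ne _ _ n2)
      (ne _ _ n5) (ne _ _ n10) (hl _ _) (hr _ _ n1) h1 (hl _ _) (hr _ _ n10) (hl _ _) (hr _ _ n3)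
      (hl _ _) (hr _ _ n6) (hl _ _) (hr _ _ n8) (hl _ _) (hr _ _ n4) (hl _ _) (hr _ _ n7)
      (hl _ _) (hr _ _ n9) h2 h3 h4 h5 h6

theorem IsQuadrilateral.card_lines {a b c d e f : F × F} (h : IsQuadrilateral a b c d e f) :
    (quadrilateralLines a b c d e f).card = 7 := by
  have hl := fun v w : F × F => onLine_lineThrough_left v w
  have hr := fun v w : F × F => @onLine_lineThrough_right F _ v w
  obtain ⟨hn, h1, h2, h3, h4, h5, h6, h7⟩ := h
  simp only [List.nodup_cons, List.mem_cons, not_or, List.not_mem_nil, not_false_eq_true,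
    List.nodup_nil, and_true] at hn
  obtain ⟨⟨nab, nac, nad, nae, naf⟩, ⟨nbc, nbd, nbe, nbf⟩, ⟨ncd, nce, ncf⟩, ⟨nde, ndf⟩, nef⟩ := hn
  have ne : ∀ v w : F × F, ¬ v.1 = w.1 → v ≠ w := fun v w h h' => h (by rw [h'])
  unfold quadrilateralLines
  rw [List.toFinset_card_of_nodup]
  · rfl
  · exact nodup_of_quadrilateral (fun v w ℓ ℓ' => OnLine.line_unique') (ne _ _ nab) (ne _ _ nac)
      (ne _ _ nbc) (ne _ _ nae) (ne _ _ nad) (ne _ _ nde) (ne _ _ nbd) (ne _ _ nbf) (ne _ _ ndf)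
      (ne _ _ nef) (ne _ _ nce) (ne _ _ ncf) (hl _ _) (hr _ _ nab) h1 (hl _ _) (hr _ _ nae) h3
      (hl _ _) (hr _ _ nbf) h4 (hl _ _) (hr _ _ nef) h2 (hl _ _) (hr _ _ naf) (hl _ _)
      (hr _ _ nbe) (hl _ _) (hr _ _ ncd) h5 h6 h7

/-- The cases follow the largest number of points of `Q` on a line. With four or more on a line, two
points off it span a line missing at least three of them, which gives a triple and a pair. With
exactly three, either such a configuration exists or the three lines spanned by three points off the
line all meet it in points of `Q`, which gives a quadrilateral. With at most two, any five points
form an arc. -/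
theorem exists_configuration (Q : Finset (F × F)) (hQ : 6 ≤ Q.card)
    (hx : ∀ v ∈ Q, ∀ w ∈ Q, v ≠ w → v.1 ≠ w.1)
    (hline : ∀ ℓ, (Q.filter fun v => OnLine v ℓ).card + 2 ≤ Q.card) :
    (∃ v : Fin 5 → F × F, (∀ i, v i ∈ Q) ∧ IsFiveArc v) ∨
    (∃ b ∈ Q, ∃ c ∈ Q, ∃ d ∈ Q, ∃ e ∈ Q, ∃ f ∈ Q, IsTriplePair b c d e f) ∨
    ∃ a ∈ Q, ∃ b ∈ Q, ∃ c ∈ Q, ∃ d ∈ Q, ∃ e ∈ Q, ∃ f ∈ Q, IsQuadrilateral a b c d e f := by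
  have hj : ∀ v ∈ Q, ∀ w ∈ Q, v ≠ w → ∀ ℓ, OnLine v ℓ → OnLine w ℓ → ℓ = lineThrough v w :=
    fun v hv w hw hvw ℓ h1 h2 => OnLine.line_unique (hx v hv w hw hvw) h1 h2
      (onLine_lineThrough_left _ _) (onLine_lineThrough_right (hx v hv w hw hvw))
  have hl := fun v w : F × F => onLine_lineThrough_left v w
  have hr : ∀ v ∈ Q, ∀ w ∈ Q, v ≠ w → OnLine w (lineThrough v w) := fun v hv w hw hvw =>
    onLine_lineThrough_right (hx v hv w hw hvw)
  have hoff : ∀ ℓ, (Q.filter fun v => OnLine v ℓ).card +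
      (Q.filter fun v => ¬ OnLine v ℓ).card = Q.card := fun ℓ =>
    Finset.card_filter_add_card_filter_not _
  have htp : ∀ b ∈ Q, ∀ c ∈ Q, ∀ d ∈ Q, ∀ e ∈ Q, ∀ f ∈ Q, b ≠ c → b ≠ d → c ≠ d → e ≠ f →
      ∀ ℓ, OnLine b ℓ → OnLine c ℓ → OnLine d ℓ → ¬ OnLine e ℓ → ¬ OnLine f ℓ →
      ¬ OnLine b (lineThrough e f) → ¬ OnLine c (lineThrough e f) → ¬ OnLine d (lineThrough e f) →
      IsTriplePair b c d e f := by
    intro b hb c hc d hd e he f hf hbc hbd hcd hef ℓ hbl hcl hdl hel hfl h1 h2 h3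
    have hbe : b ≠ e := fun h => hel (h ▸ hbl)
    have hce : c ≠ e := fun h => hel (h ▸ hcl)
    have hde : d ≠ e := fun h => hel (h ▸ hdl)
    have hbf : b ≠ f := fun h => hfl (h ▸ hbl)
    have hcf : c ≠ f := fun h => hfl (h ▸ hcl)
    have hdf : d ≠ f := fun h => hfl (h ▸ hdl)
    have hℓ := hj b hb c hc hbc ℓ hbl hcl
    rw [hℓ] at hdl hel hfl
    refine ⟨?_, hdl, hel, hfl, h1, h2, h3⟩
    simp only [List.nodup_cons, List.mem_cons, not_or, List.not_mem_nil, not_false_eq_true,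
      List.nodup_nil, and_true]
    exact ⟨⟨hx b hb c hc hbc, hx b hb d hd hbd, hx b hb e he hbe, hx b hb f hf hbf⟩,
      ⟨hx c hc d hd hcd, hx c hc e he hce, hx c hc f hf hcf⟩,
      ⟨hx d hd e he hde, hx d hd f hf hdf⟩, hx e he f hf hef⟩
  by_cases h4 : ∃ ℓ, 4 ≤ (Q.filter fun v => OnLine v ℓ).card
  · right; left
    obtain ⟨ℓ, hℓ⟩ := h4
    obtain ⟨e, he, f, hf, hef⟩ := Finset.one_lt_card.1
      (by have := hoff ℓ; have := hline ℓ; omega : 1 < (Q.filter fun v => ¬ OnLine v ℓ).card)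
    rw [Finset.mem_filter] at he hf
    -- The line through `e` and `f` differs from `ℓ`, so it removes at most one of the four points.
    have hle1 : ((Q.filter fun v => OnLine v ℓ).filter fun v => OnLine v (lineThrough e f)).card ≤ 1 := by
      rw [Finset.card_le_one]
      intro v hv w hw
      simp only [Finset.mem_filter] at hv hw
      by_contra hvw
      have h1 := hj v hv.1.1 w hw.1.1 hvw _ hv.1.2 hw.1.2
      have h2 := hj v hv.1.1 w hw.1.1 hvw _ hv.2 hw.2
      exact he.2 (h1.trans h2.symm ▸ hl e f)
    have h3 : 2 < ((Q.filter fun v => OnLine v ℓ).filter fun v => ¬ OnLine v (lineThrough e f)).card := by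
      have := Finset.card_filter_add_card_filter_not (s := Q.filter fun v => OnLine v ℓ)
        (fun v => OnLine v (lineThrough e f))
      omega
    obtain ⟨b, hb, c, hc, d, hd, hbc, hbd, hcd⟩ := Finset.two_lt_card.1 h3
    simp only [Finset.mem_filter] at hb hc hd
    exact ⟨b, hb.1.1, c, hc.1.1, d, hd.1.1, e, he.1, f, hf.1, htp b hb.1.1 c hc.1.1 d hd.1.1 e he.1
      f hf.1 hbc hbd hcd hef ℓ hb.1.2 hc.1.2 hd.1.2 he.2 hf.2 hb.2 hc.2 hd.2⟩
  push Not at h4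
  have hno4 : ∀ ℓ, ∀ v ∈ Q, ∀ w ∈ Q, ∀ x ∈ Q, ∀ y ∈ Q, v ≠ w → v ≠ x → v ≠ y → w ≠ x → w ≠ y →
      x ≠ y → OnLine v ℓ → OnLine w ℓ → OnLine x ℓ → OnLine y ℓ → False := by
    intro ℓ v hv w hw x hx' y hy h1 h2 h3 h4' h5 h6 h7 h8 h9 h10
    have hsub : ({v, w, x, y} : Finset (F × F)) ⊆ Q.filter fun v => OnLine v ℓ := by
      intro z hz
      simp only [Finset.mem_insert, Finset.mem_singleton] at hz
      rcases hz with rfl | rfl | rfl | rfl <;> simp [*]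
    have := Finset.card_le_card hsub
    rw [Finset.card_eq_succ_iff_cons.2 ⟨v, {w, x, y}, by simp [h1, h2, h3], by simp, by
      rw [Finset.card_eq_three]; exact ⟨w, x, y, h4', h5, h6, rfl⟩⟩] at this
    have := h4 ℓ
    omega
  by_cases h3 : ∃ ℓ, 3 ≤ (Q.filter fun v => OnLine v ℓ).card
  · right
    obtain ⟨ℓ, hℓ⟩ := h3
    obtain ⟨a, ha, b, hb, c, hc, hab, hac, hbc⟩ := Finset.two_lt_card.1 hℓ
    obtain ⟨d, hd, e, he, f, hf, hde, hdf, hef⟩ := Finset.two_lt_card.1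
      (by have := hoff ℓ; have := h4 ℓ; omega : 2 < (Q.filter fun v => ¬ OnLine v ℓ).card)
    simp only [Finset.mem_filter] at ha hb hc hd he hf
    by_cases hB : ∃ b ∈ Q, ∃ c ∈ Q, ∃ d ∈ Q, ∃ e ∈ Q, ∃ f ∈ Q, IsTriplePair b c d e f
    · exact Or.inl hB
    right
    -- Otherwise `a`, `b`, `c` with `u`, `w` would be a triple and a pair.
    have hmeet : ∀ u ∈ Q, ∀ w ∈ Q, u ≠ w → ¬ OnLine u ℓ → ¬ OnLine w ℓ →
        ∃ z ∈ Q, OnLine z ℓ ∧ OnLine z (lineThrough u w) := by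
      intro u hu w hw huw hul hwl
      by_contra hcon
      push Not at hcon
      exact hB ⟨a, ha.1, b, hb.1, c, hc.1, u, hu, w, hw, htp a ha.1 b hb.1 c hc.1 u hu w hw hab hac
        hbc huw ℓ ha.2 hb.2 hc.2 hul hwl (hcon a ha.1 ha.2) (hcon b hb.1 hb.2) (hcon c hc.1 hc.2)⟩
    obtain ⟨x, hxQ, hxl, hx1⟩ := hmeet d hd.1 e he.1 hde hd.2 he.2
    obtain ⟨y, hyQ, hyl, hy1⟩ := hmeet d hd.1 f hf.1 hdf hd.2 hf.2
    obtain ⟨z, hzQ, hzl, hz1⟩ := hmeet e he.1 f hf.1 hef he.2 hf.2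
    have hne : ∀ u w, OnLine u ℓ → ¬ OnLine w ℓ → u ≠ w := fun u w h1 h2 h => h2 (h ▸ h1)
    have r1 := hr d hd.1 e he.1 hde
    have r2 := hr d hd.1 f hf.1 hdf
    have r3 := hr e he.1 f hf.1 hef
    have hxd := hne x d hxl hd.2
    have hxe := hne x e hxl he.2
    have hxf := hne x f hxl hf.2
    have hyd := hne y d hyl hd.2
    have hye := hne y e hyl he.2
    have hyf := hne y f hyl hf.2
    have hzd := hne z d hzl hd.2
    have hze := hne z e hzl he.2
    have hzf := hne z f hzl hf.2
    -- A coincidence among `x`, `y`, `z` would put `d`, `e`, `f` and that point on one line, but no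
    -- line contains four points.
    have hxy : x ≠ y := by
      rintro rfl
      have h1 := hj x hxQ d hd.1 hxd _ hx1 (hl d e)
      have h2 := hj x hxQ d hd.1 hxd _ hy1 (hl d f)
      exact hno4 (lineThrough d e) x hxQ d hd.1 e he.1 f hf.1 hxd hxe hxf hde hdf hef hx1 (hl _ _) r1
        (by rw [h1, ← h2]; exact r2)
    have hxz : x ≠ z := by
      rintro rfl
      have h1 := hj x hxQ e he.1 hxe _ hx1 r1
      have h2 := hj x hxQ e he.1 hxe _ hz1 (hl e f)
      exact hno4 (lineThrough d e) x hxQ d hd.1 e he.1 f hf.1 hxd hxe hxf hde hdf hef hx1 (hl _ _) r1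
        (by rw [h1, ← h2]; exact r3)
    have hyz : y ≠ z := by
      rintro rfl
      have h1 := hj y hyQ f hf.1 hyf _ hy1 r2
      have h2 := hj y hyQ f hf.1 hyf _ hz1 r3
      exact hno4 (lineThrough d f) y hyQ d hd.1 e he.1 f hf.1 hyd hye hyf hde hdf hef hy1 (hl _ _)
        (by rw [h1, ← h2]; exact hl e f) r2
    have hℓ' := hj x hxQ y hyQ hxy ℓ hxl hyl
    have j1 := hj x hxQ e he.1 hxe _ hx1 r1
    have j2 := hj y hyQ f hf.1 hyf _ hy1 r2
    refine ⟨x, hxQ, y, hyQ, z, hzQ, d, hd.1, e, he.1, f, hf.1, ?_, hℓ' ▸ hzl, hz1,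
      j1 ▸ hl d e, j2 ▸ hl d f, hℓ' ▸ hd.2, hℓ' ▸ he.2, hℓ' ▸ hf.2⟩
    simp only [List.nodup_cons, List.mem_cons, not_or, List.not_mem_nil, not_false_eq_true,
      List.nodup_nil, and_true]
    exact ⟨⟨hx x hxQ y hyQ hxy, hx x hxQ z hzQ hxz, hx x hxQ d hd.1 hxd, hx x hxQ e he.1 hxe,
      hx x hxQ f hf.1 hxf⟩, ⟨hx y hyQ z hzQ hyz, hx y hyQ d hd.1 hyd, hx y hyQ e he.1 hye,
      hx y hyQ f hf.1 hyf⟩, ⟨hx z hzQ d hd.1 hzd, hx z hzQ e he.1 hze, hx z hzQ f hf.1 hzf⟩,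
      ⟨hx d hd.1 e he.1 hde, hx d hd.1 f hf.1 hdf⟩, hx e he.1 f hf.1 hef⟩
  · left
    push Not at h3
    obtain ⟨R, hRQ, hR⟩ := Finset.exists_subset_card_eq (by omega : 5 ≤ Q.card)
    have eR := (R.equivFinOfCardEq hR).symm
    have hinj : ∀ i j, i ≠ j → (eR i : F × F) ≠ eR j := fun i j hij h =>
      hij (eR.injective (Subtype.ext h))
    have hmem : ∀ i, (eR i : F × F) ∈ Q := fun i => hRQ (eR i).2
    refine ⟨fun i => eR i, hmem, fun i j hij => hx _ (hmem i) _ (hmem j) (hinj i j hij), ?_⟩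
    intro i j k hij hik hjk hk
    have : 2 < (Q.filter fun v => OnLine v (lineThrough (eR i : F × F) (eR j))).card := by
      rw [Finset.two_lt_card]
      refine ⟨eR i, ?_, eR j, ?_, eR k, ?_, hinj _ _ hij, hinj _ _ hik, hinj _ _ hjk⟩
      · simp [hmem, hl]
      · simp [hmem, hr _ (hmem i) _ (hmem j) (hinj _ _ hij)]
      · simp [hmem, hk]
    have := h3 (lineThrough (eR i : F × F) (eR j))
    omega

end Geometry

/-! ### The random graph and its forbidden configurations. -/

/-- Independence of coordinates in counting form: probabilities are proportions of the finite space
of outcomes. -/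
theorem card_filter_forall_mem_le {ι κ : Type*} [Fintype ι] [DecidableEq ι] [Fintype κ]
    [DecidableEq κ] (T : Finset ι) (A : ι → Finset κ) (p : ℝ)
    (hA : ∀ i ∈ T, ((A i).card : ℝ) ≤ p * Fintype.card κ) :
    ((Finset.univ.filter fun ω : ι → κ => ∀ i ∈ T, ω i ∈ A i).card : ℝ) ≤
      p ^ T.card * Fintype.card (ι → κ) := by
  have h : (Finset.univ.filter fun ω : ι → κ => ∀ i ∈ T, ω i ∈ A i) =
      Fintype.piFinset fun i => if i ∈ T then A i else Finset.univ := by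
    ext ω
    simp only [Finset.mem_filter, Finset.mem_univ, true_and, Fintype.mem_piFinset]
    refine forall_congr' fun i => ?_
    by_cases hi : i ∈ T <;> simp [hi]
  rw [h, Fintype.card_piFinset]
  push_cast
  calc ∏ i, (((if i ∈ T then A i else Finset.univ : Finset κ).card : ℕ) : ℝ)
      ≤ ∏ i, (if i ∈ T then p else 1) * (Fintype.card κ : ℝ) := by
        refine Finset.prod_le_prod (fun _ _ => by positivity) fun i _ => ?_
        by_cases hi : i ∈ T
        · simpa [hi] using hA i hi
        · simp [hi]
    _ = p ^ T.card * Fintype.card (ι → κ) := by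
        rw [Finset.prod_mul_distrib, Finset.prod_ite_mem, Fintype.card_fun]
        simp

section RandomLines

variable {F : Type*} [Field F] {M s : ℕ}

/-- Every line receives a number below `M`, the line being active if this number is zero, and a
colouring of its points, indexed by the first coordinate, with `s` colours. -/
abbrev LineData (F : Type*) (M s : ℕ) := F × F → Fin M × (F → Fin s)

/-- The line `ℓ` is active. -/
def IsActive (ω : LineData F M s) (ℓ : F × F) : Prop := ((ω ℓ).1 : ℕ) = 0

instance (ω : LineData F M s) (ℓ : F × F) : Decidable (IsActive ω ℓ) :=
  inferInstanceAs (Decidable (_ = _))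

/-- Two points are adjacent if they lie on a common active line and differ in colour there. -/
def lineGraph (ω : LineData F M s) : SimpleGraph (F × F) where
  Adj v w := ∃ ℓ, IsActive ω ℓ ∧ OnLine v ℓ ∧ OnLine w ℓ ∧ (ω ℓ).2 v.1 ≠ (ω ℓ).2 w.1
  symm := ⟨fun _ _ ⟨ℓ, h, hv, hw, hc⟩ => ⟨ℓ, h, hw, hv, hc.symm⟩⟩
  loopless := ⟨fun _ ⟨_, _, _, _, hc⟩ => hc rfl⟩

variable [DecidableEq F] [Fintype F]

/-- The five-arcs all of whose lines are active. -/
noncomputable def activeFiveArcs (ω : LineData F M s) : Finset (Fin 5 → F × F) := by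
  classical exact Finset.univ.filter fun v => IsFiveArc v ∧ ∀ ℓ ∈ fiveArcLines v, IsActive ω ℓ

/-- The triples with a pair all of whose lines are active. -/
noncomputable def activeTriplePairs (ω : LineData F M s) :
    Finset ((F × F) × (F × F) × (F × F) × (F × F) × (F × F)) := by
  classical exact Finset.univ.filter fun v =>
    IsTriplePair v.1 v.2.1 v.2.2.1 v.2.2.2.1 v.2.2.2.2 ∧
      ∀ ℓ ∈ triplePairLines v.1 v.2.1 v.2.2.1 v.2.2.2.1 v.2.2.2.2, IsActive ω ℓ

/-- The complete quadrilaterals all of whose sides and diagonals are active. -/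
noncomputable def activeQuadrilaterals (ω : LineData F M s) :
    Finset ((F × F) × (F × F) × (F × F) × (F × F) × (F × F) × (F × F)) := by
  classical exact Finset.univ.filter fun v =>
    IsQuadrilateral v.1 v.2.1 v.2.2.1 v.2.2.2.1 v.2.2.2.2.1 v.2.2.2.2.2 ∧
      ∀ ℓ ∈ quadrilateralLines v.1 v.2.1 v.2.2.1 v.2.2.2.1 v.2.2.2.2.1 v.2.2.2.2.2, IsActive ω ℓ

/-- The number of forbidden configurations spanned by active lines. -/
noncomputable def numConfigurations (ω : LineData F M s) : ℕ :=
  (activeFiveArcs ω).card + (activeTriplePairs ω).card + (activeQuadrilaterals ω).card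

/-- A set of vertices meeting all forbidden configurations. -/
noncomputable def configurationCover (ω : LineData F M s) : Finset (F × F) :=
  (activeFiveArcs ω).image (fun v => v 0) ∪ (activeTriplePairs ω).image (fun v => v.1) ∪
    (activeQuadrilaterals ω).image fun v => v.1

theorem card_configurationCover_le (ω : LineData F M s) :
    (configurationCover ω).card ≤ numConfigurations ω :=
  (Finset.card_union_le _ _).trans (Nat.add_le_add ((Finset.card_union_le _ _).trans
    (Nat.add_le_add Finset.card_image_le Finset.card_image_le)) Finset.card_image_le)

/-- Every line joining two points of a clique is active, so any configuration found inside the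
clique is counted; `4 ≤ s` provides the six points needed to find one. -/
theorem exists_mem_configurationCover (hs : 4 ≤ s) (ω : LineData F M s) (Q : Finset (F × F))
    (hQ : (lineGraph ω).IsNClique (s + 2) Q) : ∃ v ∈ Q, v ∈ configurationCover ω := by
  have hadj : ∀ v ∈ Q, ∀ w ∈ Q, v ≠ w → (lineGraph ω).Adj v w := fun v hv w hw h =>
    hQ.isClique hv hw h
  have hx : ∀ v ∈ Q, ∀ w ∈ Q, v ≠ w → v.1 ≠ w.1 := fun v hv w hw h => by
    obtain ⟨ℓ, -, h1, h2, -⟩ := hadj v hv w hw h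
    exact h1.fst_ne h2 h
  have hact : ∀ v ∈ Q, ∀ w ∈ Q, v.1 ≠ w.1 → IsActive ω (lineThrough v w) := by
    intro v hv w hw h
    obtain ⟨ℓ, ha, h1, h2, -⟩ := hadj v hv w hw fun h' => h (by rw [h'])
    rwa [OnLine.line_unique h (onLine_lineThrough_left v w) (onLine_lineThrough_right h) h1 h2]
  have hline : ∀ ℓ, (Q.filter fun v => OnLine v ℓ).card + 2 ≤ Q.card := by
    intro ℓ
    rw [hQ.card_eq]
    -- Two clique points on `ℓ` can be adjacent only through `ℓ`, hence have different colours
    -- there, and there are `s` colours.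
    have : (Q.filter fun v => OnLine v ℓ).card ≤ (Finset.univ : Finset (Fin s)).card := by
      refine Finset.card_le_card_of_injOn (fun v => (ω ℓ).2 v.1) (fun _ _ => Finset.mem_univ _) ?_
      intro v hv w hw hvw
      simp only [Finset.coe_filter, Set.mem_ofPred_eq] at hv hw
      by_contra hne
      obtain ⟨ℓ', -, h1, h2, h3⟩ := hadj v hv.1 w hw.1 hne
      rw [OnLine.line_unique' hne h1 h2 hv.2 hw.2] at h3
      exact h3 hvw
    simp only [Finset.card_univ, Fintype.card_fin] at this
    omega
  rcases exists_configuration Q (by rw [hQ.card_eq]; omega) hx hline with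
    ⟨v, hv, h⟩ | ⟨b, hb, c, hc, d, hd, e, he, f, hf, h⟩ |
    ⟨a, ha, b, hb, c, hc, d, hd, e, he, f, hf, h⟩
  · refine ⟨v 0, hv 0, ?_⟩
    refine Finset.mem_union_left _ (Finset.mem_union_left _ (Finset.mem_image.2 ⟨v, ?_, rfl⟩))
    simp only [activeFiveArcs, Finset.mem_filter, Finset.mem_univ, true_and]
    refine ⟨h, fun ℓ hℓ => ?_⟩
    simp only [fiveArcLines, Finset.mem_image, Finset.mem_filter, Finset.mem_univ, true_and] at hℓ
    obtain ⟨p, hp, rfl⟩ := hℓ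
    exact hact _ (hv _) _ (hv _) (h.1 _ _ hp.ne)
  · refine ⟨b, hb, ?_⟩
    refine Finset.mem_union_left _ (Finset.mem_union_right _
      (Finset.mem_image.2 ⟨(b, c, d, e, f), ?_, rfl⟩))
    simp only [activeTriplePairs, Finset.mem_filter, Finset.mem_univ, true_and]
    refine ⟨h, fun ℓ hℓ => ?_⟩
    have hn := h.1
    simp only [List.nodup_cons, List.mem_cons, not_or, List.not_mem_nil, not_false_eq_true,
      List.nodup_nil, and_true] at hn
    obtain ⟨⟨n1, n2, n3, n4⟩, ⟨n5, n6, n7⟩, ⟨n8, n9⟩, n10⟩ := hn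
    simp only [triplePairLines, List.mem_toFinset, List.mem_cons, List.not_mem_nil, or_false] at hℓ
    rcases hℓ with rfl | rfl | rfl | rfl | rfl | rfl | rfl | rfl <;> apply hact <;> assumption
  · refine ⟨a, ha, ?_⟩
    refine Finset.mem_union_right _ (Finset.mem_image.2 ⟨(a, b, c, d, e, f), ?_, rfl⟩)
    simp only [activeQuadrilaterals, Finset.mem_filter, Finset.mem_univ, true_and]
    refine ⟨h, fun ℓ hℓ => ?_⟩
    have hn := h.1
    simp only [List.nodup_cons, List.mem_cons, not_or, List.not_mem_nil, not_false_eq_true,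
      List.nodup_nil, and_true] at hn
    obtain ⟨⟨nab, nac, nad, nae, naf⟩, ⟨nbc, nbd, nbe, nbf⟩, ⟨ncd, nce, ncf⟩, ⟨nde, ndf⟩, nef⟩ := hn
    simp only [quadrilateralLines, List.mem_toFinset, List.mem_cons, List.not_mem_nil,
      or_false] at hℓ
    rcases hℓ with rfl | rfl | rfl | rfl | rfl | rfl | rfl <;> apply hact <;> assumption

theorem card_filter_isActive_le (hM : 0 < M) (T : Finset (F × F)) :
    ((Finset.univ.filter fun ω : LineData F M s => ∀ ℓ ∈ T, IsActive ω ℓ).card : ℝ) ≤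
      (1 / M) ^ T.card * Fintype.card (LineData F M s) := by
  refine card_filter_forall_mem_le T (fun _ => Finset.univ.filter fun x => (x.1 : ℕ) = 0) _
    (fun _ _ => ?_) |>.trans' ?_
  · have h1 : (Finset.univ.filter fun x : Fin M × (F → Fin s) => (x.1 : ℕ) = 0) =
        ({⟨0, hM⟩} : Finset (Fin M)) ×ˢ Finset.univ := by
      ext x
      simp only [Finset.mem_filter, Finset.mem_univ, true_and, Finset.mem_product,
        Finset.mem_singleton, and_true, Fin.ext_iff]
    rw [h1, Finset.card_product, Fintype.card_prod, Fintype.card_fin]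
    have : (M : ℝ) ≠ 0 := by positivity
    push_cast
    rw [Finset.card_singleton, Finset.card_univ]
    field_simp
    simp
  · simp [IsActive]

/-- Linearity of expectation: each configuration spanning `m` lines survives with probability at
most `(1 / M) ^ m`. -/
theorem sum_card_filter_isActive_le {ι : Type*} (hM : 0 < M) (I : Finset ι)
    (T : ι → Finset (F × F)) (m : ℕ) (hT : ∀ i ∈ I, (T i).card = m) :
    ∑ ω : LineData F M s, ((I.filter fun i => ∀ ℓ ∈ T i, IsActive ω ℓ).card : ℝ) ≤
      I.card * (1 / M) ^ m * Fintype.card (LineData F M s) := by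
  have h1 : ∑ ω : LineData F M s, ((I.filter fun i => ∀ ℓ ∈ T i, IsActive ω ℓ).card : ℝ) =
      ∑ i ∈ I, ((Finset.univ.filter fun ω : LineData F M s =>
        ∀ ℓ ∈ T i, IsActive ω ℓ).card : ℝ) := by
    simp only [Finset.card_filter, Nat.cast_sum]
    exact Finset.sum_comm
  rw [h1, mul_assoc, ← nsmul_eq_mul]
  refine Finset.sum_le_card_nsmul _ _ _ fun i hi => ?_
  rw [← hT i hi]
  exact card_filter_isActive_le hM (T i)

theorem sum_card_activeFiveArcs_le (hM : 0 < M) :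
    ∑ ω : LineData F M s, ((activeFiveArcs ω).card : ℝ) ≤
      (Fintype.card F) ^ 10 * (1 / M) ^ 10 * Fintype.card (LineData F M s) := by
  classical
  have h := sum_card_filter_isActive_le (s := s) hM
    (Finset.univ.filter fun v : Fin 5 → F × F => IsFiveArc v) fiveArcLines 10
    (fun i hi => (Finset.mem_filter.1 hi).2.card_lines)
  simp only [Finset.filter_filter] at h
  refine le_trans (le_of_eq ?_) (h.trans ?_)
  · unfold activeFiveArcs
    congr!
  · gcongr
    have : (Finset.univ.filter fun v : Fin 5 → F × F => IsFiveArc v).card ≤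
        Fintype.card (Fin 5 → F × F) := Finset.card_le_univ _
    rw [Fintype.card_fun, Fintype.card_prod, Fintype.card_fin] at this
    calc ((Finset.univ.filter fun v : Fin 5 → F × F => IsFiveArc v).card : ℝ) ≤
        ((Fintype.card F * Fintype.card F) ^ 5 : ℕ) := by exact_mod_cast this
      _ = _ := by push_cast; ring

theorem sum_card_activeTriplePairs_le (hM : 0 < M) :
    ∑ ω : LineData F M s, ((activeTriplePairs ω).card : ℝ) ≤
      (Fintype.card F) ^ 9 * (1 / M) ^ 8 * Fintype.card (LineData F M s) := by
  classical
  set I := Finset.univ.filter fun v : (F × F) × (F × F) × (F × F) × (F × F) × (F × F) =>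
    IsTriplePair v.1 v.2.1 v.2.2.1 v.2.2.2.1 v.2.2.2.2 with hI
  have h := sum_card_filter_isActive_le (s := s) hM I
    (fun v => triplePairLines v.1 v.2.1 v.2.2.1 v.2.2.2.1 v.2.2.2.2) 8
    (fun i hi => (Finset.mem_filter.1 hi).2.card_lines)
  simp only [hI, Finset.filter_filter] at h
  refine le_trans (le_of_eq ?_) (h.trans ?_)
  · unfold activeTriplePairs
    congr!
  · gcongr
    -- Nine degrees of freedom instead of ten: `d` lies on the line through `b` and `c`, so its
    -- first coordinate determines it.
    have : I.card ≤ (Finset.univ : Finset ((F × F) × (F × F) × F × (F × F) × (F × F))).card := by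
      refine Finset.card_le_card_of_injOn (fun v => (v.1, v.2.1, v.2.2.1.1, v.2.2.2.1, v.2.2.2.2))
        (fun _ _ => Finset.mem_univ _) ?_
      rintro ⟨b, c, d, e, f⟩ h1 ⟨b', c', d', e', f'⟩ h2 h
      simp only [Prod.mk.injEq] at h
      obtain ⟨rfl, rfl, hd, rfl, rfl⟩ := h
      have h1 := (Finset.mem_filter.1 h1).2.2.1
      have h2 := (Finset.mem_filter.1 h2).2.2.1
      have : d = d' := by
        by_contra hne
        exact h1.fst_ne h2 hne hd
      rw [this]
    simp only [Finset.card_univ, Fintype.card_prod] at this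
    have h' : I.card ≤ Fintype.card F ^ 9 := this.trans_eq (by ring)
    exact_mod_cast h'

theorem sum_card_activeQuadrilaterals_le (hM : 0 < M) :
    ∑ ω : LineData F M s, ((activeQuadrilaterals ω).card : ℝ) ≤
      (Fintype.card F) ^ 8 * (1 / M) ^ 7 * Fintype.card (LineData F M s) := by
  classical
  set I := Finset.univ.filter fun v : (F × F) × (F × F) × (F × F) × (F × F) × (F × F) × (F × F) =>
    IsQuadrilateral v.1 v.2.1 v.2.2.1 v.2.2.2.1 v.2.2.2.2.1 v.2.2.2.2.2 with hI
  have h := sum_card_filter_isActive_le (s := s) hM I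
    (fun v => quadrilateralLines v.1 v.2.1 v.2.2.1 v.2.2.2.1 v.2.2.2.2.1 v.2.2.2.2.2) 7
    (fun i hi => (Finset.mem_filter.1 hi).2.card_lines)
  simp only [hI, Finset.filter_filter] at h
  refine le_trans (le_of_eq ?_) (h.trans ?_)
  · unfold activeQuadrilaterals
    congr!
  · gcongr
    -- Eight degrees of freedom: `c` and `d` are intersections of lines determined by `a`, `b`, `e`,
    -- `f`.
    have : I.card ≤ (Finset.univ : Finset ((F × F) × (F × F) × (F × F) × (F × F))).card := by
      refine Finset.card_le_card_of_injOn (fun v => (v.1, v.2.1, v.2.2.2.2.1, v.2.2.2.2.2))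
        (fun _ _ => Finset.mem_univ _) ?_
      rintro ⟨a, b, c, d, e, f⟩ h1 ⟨a', b', c', d', e', f'⟩ h2 h
      simp only [Prod.mk.injEq] at h
      obtain ⟨rfl, rfl, rfl, rfl⟩ := h
      obtain ⟨hn, k1, k2, k3, k4, -, k5, k6⟩ := (Finset.mem_filter.1 h1).2
      obtain ⟨-, l1, l2, l3, l4, -⟩ := (Finset.mem_filter.1 h2).2
      simp only [List.nodup_cons, List.mem_cons, not_or, List.not_mem_nil, not_false_eq_true,
        List.nodup_nil, and_true] at hn k1 k2 k3 k4 k5 k6 l1 l2 l3 l4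
      have hab : a.1 ≠ b.1 := hn.1.1
      have hae : a.1 ≠ e.1 := hn.1.2.2.2.1
      have hc : c = c' := by
        refine OnLine.point_unique (fun h => k5 ?_) k1 l1 k2 l2
        rw [h]; exact onLine_lineThrough_left _ _
      have hd : d = d' := by
        refine OnLine.point_unique (fun h => k5 ?_) k3 l3 k4 l4
        have hb : OnLine b (lineThrough a e) := by rw [h]; exact onLine_lineThrough_left _ _
        rw [OnLine.line_unique hab (onLine_lineThrough_left a b) (onLine_lineThrough_right hab)
          (onLine_lineThrough_left a e) hb]
        exact onLine_lineThrough_right hae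
      rw [hc, hd]
    simp only [Finset.card_univ, Fintype.card_prod] at this
    have h' : I.card ≤ Fintype.card F ^ 8 := this.trans_eq (by ring)
    exact_mod_cast h'

end RandomLines

/-! ### Large point sets almost surely contain K_s. -/

section Hitting

variable {F : Type*} [Field F] [DecidableEq F] [Fintype F]

theorem card_lines_through (v : F × F) :
    (Finset.univ.filter fun ℓ : F × F => OnLine v ℓ).card = Fintype.card F := by
  have : (Finset.univ.filter fun ℓ : F × F => OnLine v ℓ) =
      Finset.univ.image fun m : F => (m, v.2 - m * v.1) := by
    ext ⟨m, k⟩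
    simp only [Finset.mem_filter, Finset.mem_univ, true_and, Finset.mem_image, Prod.mk.injEq]
    constructor
    · intro (h : v.2 = m * v.1 + k)
      exact ⟨m, rfl, by rw [h]; ring⟩
    · rintro ⟨m', rfl, rfl⟩
      change v.2 = m' * v.1 + (v.2 - m' * v.1)
      ring
  rw [this, Finset.card_image_of_injective _ fun a b h => (Prod.mk.inj h).1, Finset.card_univ]

theorem card_lines_through_pair_le {v w : F × F} (h : v ≠ w) :
    (Finset.univ.filter fun ℓ : F × F => OnLine v ℓ ∧ OnLine w ℓ).card ≤ 1 := by
  rw [Finset.card_le_one]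
  intro a ha b hb
  simp only [Finset.mem_filter, Finset.mem_univ, true_and] at ha hb
  exact OnLine.line_unique' h ha.1 ha.2 hb.1 hb.2

theorem sum_card_filter_onLine (W : Finset (F × F)) :
    ∑ ℓ, (W.filter fun v => OnLine v ℓ).card = W.card * Fintype.card F := by
  simp only [Finset.card_filter]
  rw [Finset.sum_comm]
  simp only [← Finset.card_filter, card_lines_through, Finset.sum_const, smul_eq_mul]

/-- Counts ordered pairs on a common line: a point lies on q lines, and two distinct points on at
most one. -/
theorem sum_card_filter_onLine_sq_le (W : Finset (F × F)) :
    ∑ ℓ, (W.filter fun v => OnLine v ℓ).card ^ 2 ≤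
      W.card * Fintype.card F + W.card * W.card := by
  have h : ∀ ℓ, (W.filter fun v => OnLine v ℓ).card ^ 2 =
      ∑ v ∈ W, ∑ w ∈ W, if OnLine v ℓ ∧ OnLine w ℓ then 1 else 0 := by
    intro ℓ
    rw [sq, Finset.card_filter, Finset.sum_mul_sum]
    refine Finset.sum_congr rfl fun v _ => Finset.sum_congr rfl fun w _ => ?_
    by_cases h1 : OnLine v ℓ <;> by_cases h2 : OnLine w ℓ <;> simp [h1, h2]
  simp only [h]
  rw [Finset.sum_comm, ← Nat.mul_add, ← smul_eq_mul]
  refine Finset.sum_le_card_nsmul _ _ _ fun v hv => ?_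
  rw [Finset.sum_comm, ← Finset.add_sum_erase _ _ hv]
  refine Nat.add_le_add ?_ ?_
  · simp only [and_self]
    rw [← Finset.card_filter, card_lines_through]
  · refine (Finset.sum_le_card_nsmul _ _ 1 fun w hw => ?_).trans ?_
    · rw [← Finset.card_filter]
      exact card_lines_through_pair_le (Finset.ne_of_mem_erase hw).symm
    · rw [smul_eq_mul, mul_one]
      exact Finset.card_erase_le

/-- Chebyshev's inequality: a line meets `W` in 2s points on average, and the squared deviations sum
to at most 2sq². A line with fewer than s points contributes at least s², so there are at most 2q²/s
≤ q²/2 of these, using `4 ≤ s`. -/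
theorem half_le_card_rich_lines {s : ℕ} (hs : 4 ≤ s) (W : Finset (F × F))
    (hW : W.card = 2 * s * Fintype.card F) :
    (Fintype.card F : ℝ) ^ 2 / 2 ≤
      (Finset.univ.filter fun ℓ : F × F => s ≤ (W.filter fun v => OnLine v ℓ).card).card := by
  set q := Fintype.card F with hq
  set X : F × F → ℝ := fun ℓ => (W.filter fun v => OnLine v ℓ).card with hX
  have hs' : (4 : ℝ) ≤ s := by exact_mod_cast hs
  have hW' : (W.card : ℝ) = 2 * s * q := by exact_mod_cast hW
  have h1 : ∑ ℓ, X ℓ = 2 * s * q * q := by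
    have := sum_card_filter_onLine W
    rw [← hW']
    simp only [hX]
    exact_mod_cast this
  have h2 : ∑ ℓ, X ℓ ^ 2 ≤ 2 * s * q * q + 2 * s * q * (2 * s * q) := by
    have := sum_card_filter_onLine_sq_le W
    rw [← hW']
    simp only [hX]
    exact_mod_cast this
  have h3 : ∑ ℓ, (X ℓ - 2 * s) ^ 2 ≤ 2 * s * (q : ℝ) ^ 2 := by
    have : ∑ ℓ, (X ℓ - 2 * s) ^ 2 =
        ∑ ℓ, X ℓ ^ 2 - 4 * s * ∑ ℓ, X ℓ + q * q * (4 * (s : ℝ) ^ 2) := by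
      rw [Finset.mul_sum, ← Finset.sum_sub_distrib]
      have hc : (q : ℝ) * q * (4 * s ^ 2) = ∑ _ℓ : F × F, (4 * s ^ 2 : ℝ) := by
        simp [Finset.card_univ, hq]
      rw [hc, ← Finset.sum_add_distrib]
      exact Finset.sum_congr rfl fun ℓ _ => by ring
    rw [this, h1]
    nlinarith
  set P := Finset.univ.filter fun ℓ : F × F => ¬ s ≤ (W.filter fun v => OnLine v ℓ).card with hP
  have h4 : (P.card : ℝ) * s ^ 2 ≤ 2 * s * q ^ 2 := by
    refine le_trans ?_ h3
    rw [← nsmul_eq_mul]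
    refine (Finset.card_nsmul_le_sum P (fun ℓ => (X ℓ - 2 * s) ^ 2) _ fun ℓ hℓ => ?_).trans
      (Finset.sum_le_sum_of_subset_of_nonneg (Finset.subset_univ _) fun _ _ _ => sq_nonneg _)
    have h5 := (Finset.mem_filter.1 hℓ).2
    have h6 : X ℓ ≤ s := by simp only [hX]; exact_mod_cast (not_le.1 h5).le
    nlinarith
  have h5 : (P.card : ℝ) ≤ q ^ 2 / 2 := by
    have h6 : (s : ℝ) * (P.card * s) ≤ s * (2 * q ^ 2) := by linarith
    have h7 := le_of_mul_le_mul_left h6 (by linarith)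
    have h8 : (P.card : ℝ) * 4 ≤ P.card * s := by gcongr
    linarith
  have h6 := Finset.card_filter_add_card_filter_not (s := (Finset.univ : Finset (F × F)))
    (fun ℓ => s ≤ (W.filter fun v => OnLine v ℓ).card)
  rw [Finset.card_univ, Fintype.card_prod, ← hP, ← hq] at h6
  have h7 : ((Finset.univ.filter fun ℓ : F × F =>
      s ≤ (W.filter fun v => OnLine v ℓ).card).card : ℝ) + P.card = q * q := by exact_mod_cast h6
  linarith

/-- Fix one bijection from `X` to the colours and extend it arbitrarily: a random colouring is
injective on `X` with probability at least `s ^ (-s)`. -/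
theorem pow_card_le_card_injOn {s : ℕ} (X : Finset F) (hX : X.card = s) (hs : 1 ≤ s) :
    s ^ Fintype.card F ≤ (Finset.univ.filter fun g : F → Fin s =>
      ∀ x ∈ X, ∀ y ∈ X, x ≠ y → g x ≠ g y).card * s ^ s := by
  set e := X.equivFinOfCardEq hX
  set g₀ : F → Fin s := fun x => if h : x ∈ X then e ⟨x, h⟩ else ⟨0, hs⟩ with hg₀
  have hsub : (Fintype.piFinset fun x => if x ∈ X then {g₀ x} else (Finset.univ : Finset (Fin s))) ⊆
      Finset.univ.filter fun g : F → Fin s => ∀ x ∈ X, ∀ y ∈ X, x ≠ y → g x ≠ g y := by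
    intro g hg
    rw [Fintype.mem_piFinset] at hg
    have hg' : ∀ x (hx : x ∈ X), g x = e ⟨x, hx⟩ := by
      intro x hx
      have := hg x
      simpa [hx, hg₀] using this
    simp only [Finset.mem_filter, Finset.mem_univ, true_and]
    intro x hx y hy hxy
    rw [hg' x hx, hg' y hy]
    intro h
    exact hxy (by simpa using e.injective h)
  refine le_trans (le_of_eq ?_) (Nat.mul_le_mul_right _ (Finset.card_le_card hsub))
  rw [Fintype.card_piFinset]
  have h1 : s ^ s = ∏ x, if x ∈ X then s else 1 := by
    rw [Finset.prod_ite_mem]; simp [hX]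
  rw [h1, ← Finset.prod_mul_distrib]
  have h2 : ∀ x, ((if x ∈ X then {g₀ x} else (Finset.univ : Finset (Fin s))).card *
      if x ∈ X then s else 1) = s := by
    intro x
    by_cases hx : x ∈ X <;> simp [hx]
  simp [h2]

/-- On each rich line fix `s` points of `W`. They form K_s if the line is active and colours them
injectively, which has probability at least 1/(M sˢ), independently for different lines. -/
theorem card_filter_no_clique_le {M s : ℕ} (hM : 0 < M) (hs : 4 ≤ s) (W : Finset (F × F))
    (hW : W.card = 2 * s * Fintype.card F) [DecidablePred fun ω : LineData F M s =>
      (lineGraph ω).CliqueFreeOn (W : Set (F × F)) s] :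
    ((Finset.univ.filter fun ω : LineData F M s =>
      (lineGraph ω).CliqueFreeOn (W : Set (F × F)) s).card : ℝ) ≤
      Real.exp (-((Fintype.card F : ℝ) ^ 2 / (2 * (M * s ^ s)))) *
        Fintype.card (LineData F M s) := by
  classical
  set q := Fintype.card F with hq
  set T := Finset.univ.filter fun ℓ : F × F => s ≤ (W.filter fun v => OnLine v ℓ).card with hT
  have hex : ∀ ℓ, ∃ S : Finset (F × F), ℓ ∈ T → S ⊆ W.filter (fun v => OnLine v ℓ) ∧ S.card = s := by
    intro ℓ
    by_cases h : ℓ ∈ T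
    · obtain ⟨S, h1, h2⟩ := Finset.exists_subset_card_eq (Finset.mem_filter.1 h).2
      exact ⟨S, fun _ => ⟨h1, h2⟩⟩
    · exact ⟨∅, fun h' => absurd h' h⟩
  choose S hS using hex
  set A : F × F → Finset (Fin M × (F → Fin s)) := fun ℓ => (({⟨0, hM⟩} : Finset (Fin M)) ×ˢ
    Finset.univ.filter fun g : F → Fin s =>
      ∀ x ∈ (S ℓ).image Prod.fst, ∀ y ∈ (S ℓ).image Prod.fst, x ≠ y → g x ≠ g y)ᶜ with hA
  have hs0 : 1 ≤ s := by omega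
  set K : ℝ := M * s ^ s with hK
  have hKpos : 0 < K := by positivity
  have hK1 : 1 ≤ K := by
    have : 1 ≤ M * s ^ s := Nat.mul_pos hM (by positivity)
    rw [hK]; exact_mod_cast this
  have hAc : ∀ ℓ ∈ T, ((A ℓ).card : ℝ) ≤ (1 - 1 / K) * Fintype.card (Fin M × (F → Fin s)) := by
    intro ℓ hℓ
    obtain ⟨h1, h2⟩ := hS ℓ hℓ
    have hX : ((S ℓ).image Prod.fst).card = s := by
      rw [Finset.card_image_of_injOn, h2]
      intro v hv w hw hvw
      by_contra hne
      exact (Finset.mem_filter.1 (h1 hv)).2.fst_ne (Finset.mem_filter.1 (h1 hw)).2 hne hvw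
    have h3 := pow_card_le_card_injOn _ hX hs0
    set c := (Finset.univ.filter fun g : F → Fin s =>
      ∀ x ∈ (S ℓ).image Prod.fst, ∀ y ∈ (S ℓ).image Prod.fst, x ≠ y → g x ≠ g y).card with hc
    have h4 : (A ℓ).card + c = Fintype.card (Fin M × (F → Fin s)) := by
      rw [hA]
      simp only
      rw [← Finset.card_compl_add_card, Finset.card_product, Finset.card_singleton, one_mul]
    have h5 : (Fintype.card (Fin M × (F → Fin s)) : ℝ) = M * s ^ q := by
      simp [hq]
    have h4' : ((A ℓ).card : ℝ) + c = Fintype.card (Fin M × (F → Fin s)) := by exact_mod_cast h4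
    have h3' : (s : ℝ) ^ q ≤ c * s ^ s := by exact_mod_cast h3
    have h6 : 1 / K * Fintype.card (Fin M × (F → Fin s)) ≤ c := by
      rw [h5, one_div, inv_mul_le_iff₀ hKpos, hK]
      have hM0 : (0 : ℝ) ≤ M := by positivity
      nlinarith [mul_le_mul_of_nonneg_left h3' hM0]
    linarith
  have hsub : (Finset.univ.filter fun ω : LineData F M s =>
      (lineGraph ω).CliqueFreeOn (W : Set (F × F)) s) ⊆
      Finset.univ.filter fun ω : LineData F M s => ∀ ℓ ∈ T, ω ℓ ∈ A ℓ := by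
    intro ω hω
    simp only [Finset.mem_filter, Finset.mem_univ, true_and] at hω ⊢
    intro ℓ hℓ
    by_contra hcon
    simp only [hA, Finset.mem_compl, not_not, Finset.mem_product, Finset.mem_singleton,
      Finset.mem_filter, Finset.mem_univ, true_and] at hcon
    obtain ⟨h1, h2⟩ := hS ℓ hℓ
    refine hω (t := S ℓ) (fun v hv => (Finset.mem_filter.1 (h1 hv)).1) ⟨?_, h2⟩
    intro v hv w hw hvw
    have hv' := (Finset.mem_filter.1 (h1 hv)).2
    have hw' := (Finset.mem_filter.1 (h1 hw)).2
    refine ⟨ℓ, ?_, hv', hw', ?_⟩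
    · simp [IsActive, hcon.1]
    · exact hcon.2 _ (Finset.mem_image_of_mem _ hv) _ (Finset.mem_image_of_mem _ hw)
        (hv'.fst_ne hw' hvw)
  calc _ ≤ ((Finset.univ.filter fun ω : LineData F M s => ∀ ℓ ∈ T, ω ℓ ∈ A ℓ).card : ℝ) := by
        exact_mod_cast Finset.card_le_card hsub
    _ ≤ (1 - 1 / K) ^ T.card * Fintype.card (LineData F M s) :=
        card_filter_forall_mem_le T A _ hAc
    _ ≤ _ := by
        gcongr
        have h1 : 0 ≤ 1 - 1 / K := by
          rw [sub_nonneg, div_le_one hKpos]; exact hK1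
        calc (1 - 1 / K) ^ T.card ≤ (Real.exp (-(1 / K))) ^ T.card :=
              pow_le_pow_left₀ h1 (Real.one_sub_le_exp_neg _) _
          _ = Real.exp (-(T.card / K)) := by
              rw [← Real.exp_nat_mul]; congr 1; ring
          _ ≤ _ := by
              apply Real.exp_le_exp.2
              have := half_le_card_rich_lines hs W hW
              rw [neg_le_neg_iff, div_le_div_iff₀ (by positivity) hKpos]
              nlinarith

end Hitting

/-! ### Choosing a good outcome and deleting vertices. -/

section Existence

variable {F : Type*} [Field F] [DecidableEq F] [Fintype F]

theorem exists_lineData {M s : ℕ} (hM : 0 < M) (hs : 4 ≤ s)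
    (h : ((Fintype.card F : ℝ) ^ 2) ^ (2 * s * Fintype.card F) *
        Real.exp (-((Fintype.card F : ℝ) ^ 2 / (2 * (M * s ^ s)))) +
      2 / (Fintype.card F : ℝ) ^ 2 * ((Fintype.card F) ^ 10 * (1 / M) ^ 10 +
        (Fintype.card F) ^ 9 * (1 / M) ^ 8 + (Fintype.card F) ^ 8 * (1 / M) ^ 7) < 1) :
    ∃ ω : LineData F M s, 2 * numConfigurations ω ≤ Fintype.card F ^ 2 ∧
      ∀ W : Finset (F × F), W.card = 2 * s * Fintype.card F →
        ¬ (lineGraph ω).CliqueFreeOn (W : Set (F × F)) s := by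
  classical
  set q := Fintype.card F with hq
  have hq0 : (0 : ℝ) < q := by exact_mod_cast Fintype.card_pos
  set N : ℝ := ((Fintype.card (LineData F M s) : ℕ) : ℝ) with hN
  have hN0 : 0 < N := by
    have : Nonempty (LineData F M s) := ⟨fun _ => (⟨0, hM⟩, fun _ => ⟨0, by omega⟩)⟩
    rw [hN]; exact_mod_cast Fintype.card_pos
  set 𝒲 := (Finset.univ : Finset (F × F)).powersetCard (2 * s * q) with h𝒲
  set fails : LineData F M s → ℝ := fun ω =>
    ((𝒲.filter fun W : Finset (F × F) => (lineGraph ω).CliqueFreeOn (W : Set (F × F)) s).card : ℝ) with hfails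
  have h1 : ∑ ω, fails ω ≤ ((q : ℝ) ^ 2) ^ (2 * s * q) *
      Real.exp (-((q : ℝ) ^ 2 / (2 * (M * s ^ s)))) * N := by
    have h2 : ∑ ω, fails ω = ∑ W ∈ 𝒲, ((Finset.univ.filter fun ω : LineData F M s =>
        (lineGraph ω).CliqueFreeOn (W : Set (F × F)) s).card : ℝ) := by
      simp only [hfails, Finset.card_filter, Nat.cast_sum]
      exact Finset.sum_comm
    have h3 : (𝒲.card : ℝ) ≤ ((q : ℝ) ^ 2) ^ (2 * s * q) := by
      have : 𝒲.card ≤ (q * q) ^ (2 * s * q) := by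
        rw [h𝒲, Finset.card_powersetCard, Finset.card_univ, Fintype.card_prod]
        exact Nat.choose_le_pow _ _
      rw [sq]
      exact_mod_cast this
    rw [h2]
    calc _ ≤ 𝒲.card • (Real.exp (-((q : ℝ) ^ 2 / (2 * (M * s ^ s)))) * N) :=
          Finset.sum_le_card_nsmul _ _ _ fun W hW =>
            card_filter_no_clique_le hM hs W (Finset.mem_powersetCard.1 hW).2
      _ ≤ _ := by
          rw [nsmul_eq_mul, mul_assoc]
          gcongr
  have h2 : ∑ ω : LineData F M s, (numConfigurations ω : ℝ) ≤ ((q : ℝ) ^ 10 * (1 / M) ^ 10 +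
      (q : ℝ) ^ 9 * (1 / M) ^ 8 + (q : ℝ) ^ 8 * (1 / M) ^ 7) * N := by
    simp only [numConfigurations, Nat.cast_add, Finset.sum_add_distrib]
    have a1 := sum_card_activeFiveArcs_le (F := F) (s := s) hM
    have a2 := sum_card_activeTriplePairs_le (F := F) (s := s) hM
    have a3 := sum_card_activeQuadrilaterals_le (F := F) (s := s) hM
    rw [← hq, ← hN] at a1 a2 a3
    linarith
  -- One average controls both requirements: an outcome with value below 1 has no failing set, since
  -- `fails` is integral, and fewer than q²/2 configurations.
  have h3 : ∑ ω, (fails ω + 2 / (q : ℝ) ^ 2 * numConfigurations ω) <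
      ∑ _ω : LineData F M s, (1 : ℝ) := by
    rw [Finset.sum_add_distrib, ← Finset.mul_sum]
    have h4 := mul_lt_mul_of_pos_right h hN0
    have h5 := mul_le_mul_of_nonneg_left h2 (by positivity : 0 ≤ 2 / (q : ℝ) ^ 2)
    simp only [Finset.sum_const, Finset.card_univ, nsmul_eq_mul, mul_one]
    rw [← hN]
    linarith
  obtain ⟨ω, -, hω⟩ := Finset.exists_lt_of_sum_lt h3
  refine ⟨ω, ?_, fun W hW hfree => ?_⟩
  · have h4 : 0 ≤ fails ω := by simp only [hfails]; positivity
    have h5 : 2 / (q : ℝ) ^ 2 * numConfigurations ω < 1 := by linarith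
    rw [div_mul_eq_mul_div, div_lt_one (by positivity)] at h5
    exact_mod_cast h5.le
  · have h4 : 1 ≤ fails ω := by
      have : 0 < (𝒲.filter fun W : Finset (F × F) => (lineGraph ω).CliqueFreeOn (W : Set (F × F)) s).card :=
        Finset.card_pos.2 ⟨W, Finset.mem_filter.2
          ⟨Finset.mem_powersetCard.2 ⟨Finset.subset_univ _, hW⟩, hfree⟩⟩
      simp only [hfails]
      exact_mod_cast this
    have h5 : 0 ≤ 2 / (q : ℝ) ^ 2 * numConfigurations ω := by positivity
    linarith

theorem erdosRogers_le_of_lineData {M s n : ℕ} (hs : 4 ≤ s) (ω : LineData F M s)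
    (h1 : 2 * numConfigurations ω ≤ Fintype.card F ^ 2)
    (h2 : ∀ W : Finset (F × F), W.card = 2 * s * Fintype.card F →
      ¬ (lineGraph ω).CliqueFreeOn (W : Set (F × F)) s)
    (hn : 2 * n ≤ Fintype.card F ^ 2) :
    erdosRogers s (s + 2) n ≤ 2 * s * Fintype.card F := by
  classical
  -- At least half of the q² points survive the deletion.
  have hU : n ≤ (configurationCover ω)ᶜ.card := by
    have := Finset.card_compl_add_card (configurationCover ω)
    rw [Fintype.card_prod, ← sq] at this
    have := card_configurationCover_le ω
    omega
  obtain ⟨R, hRU, hR⟩ := Finset.exists_subset_card_eq hU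
  set e := (R.equivFinOfCardEq hR).symm
  set φ : Fin n ↪ F × F := e.toEmbedding.trans (Function.Embedding.subtype _) with hφ
  have hφR : ∀ i, φ i ∈ R := fun i => (e i).2
  set G := (lineGraph ω).comap φ with hG
  have hfree : G.CliqueFree (s + 2) := by
    intro Q hQ
    have hQ' : (lineGraph ω).IsNClique (s + 2) (Q.map φ) := by
      refine ⟨?_, by rw [Finset.card_map, hQ.card_eq]⟩
      rw [Finset.coe_map]
      rintro _ ⟨a, ha, rfl⟩ _ ⟨b, hb, rfl⟩ hab
      exact hQ.isClique ha hb fun h => hab (by rw [h])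
    obtain ⟨v, hv, hv'⟩ := exists_mem_configurationCover hs ω _ hQ'
    obtain ⟨i, -, rfl⟩ := Finset.mem_map.1 hv
    exact Finset.mem_compl.1 (hRU (hφR i)) hv'
  have hle : erdosRogers s (s + 2) n ≤ sIndepNum G s := Nat.sInf_le ⟨G, hfree, rfl⟩
  refine hle.trans ?_
  obtain ⟨W, hW, hWc⟩ := (sIndepNum_isGreatest G s (by omega)).1
  rw [← hWc]
  by_contra hcon
  obtain ⟨W', hW'W, hW'⟩ := Finset.exists_subset_card_eq (not_le.1 hcon).le
  refine h2 (W'.map φ) (by rw [Finset.card_map, hW']) ?_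
  rw [sIndependent_iff] at hW
  intro Q hQ hQc
  have hQφ : Q ⊆ W'.map φ := by exact_mod_cast hQ
  obtain ⟨Q', hQ', rfl⟩ := Finset.subset_map_iff.1 hQφ
  refine hW (t := Q') (by exact_mod_cast hQ'.trans hW'W) ⟨?_, by rw [← hQc.card_eq, Finset.card_map]⟩
  intro a ha b hb hab
  exact hQc.isClique (Finset.mem_coe.2 (Finset.mem_map_of_mem _ ha))
    (Finset.mem_coe.2 (Finset.mem_map_of_mem _ hb)) fun h => hab (φ.injective h)

end Existence

/-! ### Choice of parameters and conclusion. -/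

theorem eventually_exists_lineData_bound (s : ℕ) (hs : 4 ≤ s) : ∀ᶠ q : ℕ in atTop, ∃ M : ℕ, 0 < M ∧
    ((q : ℝ) ^ 2) ^ (2 * s * q) * Real.exp (-((q : ℝ) ^ 2 / (2 * (M * s ^ s)))) +
      2 / (q : ℝ) ^ 2 * ((q : ℝ) ^ 10 * (1 / M) ^ 10 +
        (q : ℝ) ^ 9 * (1 / M) ^ 8 + (q : ℝ) ^ 8 * (1 / M) ^ 7) < 1 := by
  have hs' : (4 : ℝ) ≤ s := by exact_mod_cast hs
  set S : ℝ := (s : ℝ) ^ s with hS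
  have hS1 : 1 ≤ S := one_le_pow₀ (by linarith)
  -- With M ≤ q / (K log q) the exponent q²/(2 M sˢ) is at least 6 s q log q, against 4 s q log q
  -- from the union bound.
  set K : ℝ := 12 * s * S with hK
  have hK1 : 1 ≤ K := by rw [hK]; nlinarith
  have hsmall : ∀ᶠ x : ℝ in atTop, 24 * (2 * K * Real.log x) ^ 10 ≤ x := by
    have h1 : ∀ᶠ x : ℝ in atTop, ‖Real.log x ^ 10‖ ≤ 1 / (24 * (2 * K) ^ 10) * ‖id x‖ :=
      (Real.isLittleO_pow_log_id_atTop (n := 10)).bound (by positivity)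
    filter_upwards [h1, eventually_ge_atTop 0] with x hx hx0
    simp only [Real.norm_eq_abs, id] at hx
    rw [abs_of_nonneg hx0] at hx
    have h2 := (le_abs_self _).trans hx
    rw [div_mul_eq_mul_div, one_mul, le_div_iff₀ (by positivity)] at h2
    rw [mul_pow]
    linarith
  filter_upwards [tendsto_natCast_atTop_atTop.eventually hsmall,
    (Real.tendsto_log_atTop.comp tendsto_natCast_atTop_atTop).eventually_ge_atTop 1,
    eventually_ge_atTop 1] with q hq hlog hq1
  simp only [Function.comp] at hlog
  set x : ℝ := (q : ℝ) with hx
  set y := Real.log x with hy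
  have hx1 : 1 ≤ x := by rw [hx]; exact_mod_cast hq1
  set z := 2 * K * y with hz
  have hz1 : 1 ≤ z := by rw [hz]; nlinarith
  have hzx : z ≤ x := by
    have : z ≤ z ^ 10 := le_self_pow₀ hz1 (by norm_num)
    nlinarith
  have hKy : 0 < K * y := by positivity
  have hr : 1 ≤ x / (K * y) := by rw [le_div_iff₀ hKy]; linarith
  set M := ⌊x / (K * y)⌋₊ with hM
  have hMpos : 0 < M := Nat.floor_pos.2 hr
  have hMle : (M : ℝ) ≤ x / (K * y) := Nat.floor_le (by positivity)
  have hM1 : (1 : ℝ) ≤ M := by exact_mod_cast hMpos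
  have hMge : x / (K * y) ≤ 2 * M := by
    have := Nat.lt_floor_add_one (x / (K * y))
    linarith
  -- Thus `1 / M` is log q / q up to a constant, and each expected count is at most `x * z ^ 10`;
  -- the factor 24 in `hsmall` makes the total contribution at most 1/4.
  have hu : 1 / (M : ℝ) ≤ z / x := by
    rw [div_le_div_iff₀ (by linarith) (by linarith)]
    rw [div_le_iff₀ hKy] at hMge
    rw [hz]; linarith
  refine ⟨M, hMpos, ?_⟩
  have t1 : (x ^ 2) ^ (2 * s * q) * Real.exp (-(x ^ 2 / (2 * (M * S)))) ≤ 1 / 2 := by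
    have h1 : (x ^ 2) ^ (2 * s * q) = Real.exp (4 * s * x * y) := by
      have : x = Real.exp y := (Real.exp_log (by linarith)).symm
      conv_lhs => rw [this]
      rw [← Real.exp_nat_mul, ← Real.exp_nat_mul]
      congr 1
      push_cast
      ring
    have h2 : 6 * s * x * y ≤ x ^ 2 / (2 * (M * S)) := by
      rw [le_div_iff₀ (by positivity)]
      rw [le_div_iff₀ hKy] at hMle
      calc 6 * s * x * y * (2 * (M * S)) = x * (M * (K * y)) := by rw [hK]; ring
        _ ≤ x * x := by gcongr
        _ = x ^ 2 := by ring
    rw [h1, ← Real.exp_add]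
    have h3 : 1 ≤ s * x * y := by
      have : 1 ≤ s * x := by nlinarith
      nlinarith
    calc Real.exp (4 * s * x * y + -(x ^ 2 / (2 * (M * S)))) ≤ Real.exp (-1) :=
          Real.exp_le_exp.2 (by linarith)
      _ ≤ 1 / 2 := by
          rw [Real.exp_neg, one_div]
          exact inv_anti₀ (by norm_num) (by linarith [Real.exp_one_gt_d9])
  have hu0 : 0 ≤ 1 / (M : ℝ) := by positivity
  have b1 : x ^ 10 * (1 / (M : ℝ)) ^ 10 ≤ x * z ^ 10 := by
    calc x ^ 10 * (1 / (M : ℝ)) ^ 10 ≤ x ^ 10 * (z / x) ^ 10 := by gcongr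
      _ = 1 * z ^ 10 := by field_simp
      _ ≤ x * z ^ 10 := by gcongr
  have b2 : x ^ 9 * (1 / (M : ℝ)) ^ 8 ≤ x * z ^ 10 := by
    calc x ^ 9 * (1 / (M : ℝ)) ^ 8 ≤ x ^ 9 * (z / x) ^ 8 := by gcongr
      _ = x * z ^ 8 := by field_simp
      _ ≤ x * z ^ 10 := by gcongr; norm_num
  have b3 : x ^ 8 * (1 / (M : ℝ)) ^ 7 ≤ x * z ^ 10 := by
    calc x ^ 8 * (1 / (M : ℝ)) ^ 7 ≤ x ^ 8 * (z / x) ^ 7 := by gcongr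
      _ = x * z ^ 7 := by field_simp
      _ ≤ x * z ^ 10 := by gcongr; norm_num
  have t2 : 2 / x ^ 2 * (x ^ 10 * (1 / (M : ℝ)) ^ 10 + x ^ 9 * (1 / (M : ℝ)) ^ 8 +
      x ^ 8 * (1 / (M : ℝ)) ^ 7) ≤ 1 / 4 := by
    calc _ ≤ 2 / x ^ 2 * (3 * x * z ^ 10) := by gcongr; linarith
      _ = 6 * z ^ 10 / x := by field_simp; norm_num
      _ ≤ 1 / 4 := by
          rw [div_le_div_iff₀ (by linarith) (by norm_num)]
          linarith
  linarith

theorem exists_erdosRogers_le (s : ℕ) (hs : 4 ≤ s) :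
    ∃ C : ℝ, 0 < C ∧ ∀ᶠ n : ℕ in atTop, (erdosRogers s (s + 2) n : ℝ) ≤ C * √n := by
  refine ⟨2 * s * 6, by positivity, ?_⟩
  obtain ⟨q₀, hq₀⟩ := eventually_atTop.1 (eventually_exists_lineData_bound s hs)
  filter_upwards [eventually_ge_atTop (q₀ ^ 2), eventually_ge_atTop 1] with n hn hn1
  -- Bertrand's postulate supplies a prime of order √n with q² ≥ 2n.
  obtain ⟨q, hqp, hmq, hqm⟩ := Nat.exists_prime_lt_and_le_two_mul (Nat.sqrt (2 * n) + 1) (by omega)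
  have h2n : 2 * n ≤ q ^ 2 := by
    have := Nat.lt_succ_sqrt (2 * n)
    rw [Nat.succ_eq_add_one] at this
    nlinarith
  have hq : q₀ ≤ q := by
    by_contra h
    push Not at h
    nlinarith
  obtain ⟨M, hM, hb⟩ := hq₀ q hq
  have : Fact q.Prime := ⟨hqp⟩
  have hcard : Fintype.card (ZMod q) = q := ZMod.card q
  obtain ⟨ω, h1, h2⟩ := exists_lineData (F := ZMod q) hM hs (by rw [hcard]; exact hb)
  have h3 := erdosRogers_le_of_lineData hs ω h1 h2 (by rw [hcard]; exact h2n)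
  rw [hcard] at h3
  have h4 : (q : ℝ) ≤ 6 * √n := by
    have a1 : (Nat.sqrt (2 * n) : ℝ) ≤ 2 * √n := by
      have : (2 : ℝ) * √n = √(4 * n) := by
        rw [Real.sqrt_mul (by norm_num), show (4 : ℝ) = 2 ^ 2 by norm_num,
          Real.sqrt_sq (by norm_num)]
      rw [this]
      apply Real.le_sqrt_of_sq_le
      have : Nat.sqrt (2 * n) ^ 2 ≤ 4 * n := (Nat.sqrt_le' _).trans (by omega)
      exact_mod_cast this
    have a2 : (1 : ℝ) ≤ √n := Real.one_le_sqrt.2 (by exact_mod_cast hn1)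
    have a3 : (q : ℝ) ≤ 2 * (Nat.sqrt (2 * n) + 1) := by exact_mod_cast hqm
    linarith
  calc (erdosRogers s (s + 2) n : ℝ) ≤ 2 * s * q := by exact_mod_cast h3
    _ ≤ 2 * s * (6 * √n) := by gcongr
    _ = _ := by ring

theorem erdosRogers_pos {s t n : ℕ} (hs : 2 ≤ s) (ht : 2 ≤ t) (hn : 1 ≤ n) :
    0 < erdosRogers s t n := by
  obtain ⟨G, -, hGe⟩ := (erdosRogers_isLeast s t n ht).1
  rw [← hGe]
  have h : SIndependent G s {(⟨0, hn⟩ : Fin n)} := by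
    rw [sIndependent_iff, Finset.coe_singleton, SimpleGraph.cliqueFreeOn_singleton]
    omega
  have := h.card_le (by omega)
  rw [Finset.card_singleton] at this
  omega

theorem mainTheorem4 (s : ℕ) (hs : 4 ≤ s) :
    (∃ c : ℝ, 0 < c ∧ ∀ᶠ n : ℕ in atTop,
      c * Real.sqrt (Real.log (n : ℝ) / Real.log (Real.log (n : ℝ))) ≤
        (erdosRogers (s + 1) (s + 2) n : ℝ) / (erdosRogers s (s + 2) n : ℝ)) ∧
    Tendsto (fun n : ℕ =>
        (erdosRogers (s + 1) (s + 2) n : ℝ) / (erdosRogers s (s + 2) n : ℝ))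
      atTop atTop := by
  have hmain : ∃ c : ℝ, 0 < c ∧ ∀ᶠ n : ℕ in atTop,
      c * Real.sqrt (Real.log (n : ℝ) / Real.log (Real.log (n : ℝ))) ≤
        (erdosRogers (s + 1) (s + 2) n : ℝ) / (erdosRogers s (s + 2) n : ℝ) := by
    obtain ⟨c, hc, hlow⟩ := exists_le_erdosRogers_succ s (by omega)
    obtain ⟨C, hC, hup⟩ := exists_erdosRogers_le s hs
    refine ⟨c / C, by positivity, ?_⟩
    filter_upwards [hlow, hup, eventually_ge_atTop 1] with n h1 h2 hn
    have hpos : (0 : ℝ) < erdosRogers s (s + 2) n := by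
      exact_mod_cast erdosRogers_pos (by omega) (by omega) hn
    rw [le_div_iff₀ hpos]
    rw [Real.sqrt_mul (by positivity)] at h1
    refine le_trans ?_ h1
    calc _ ≤ c / C * √(Real.log n / Real.log (Real.log n)) * (C * √n) := by gcongr
      _ = _ := by field_simp
  refine ⟨hmain, ?_⟩
  obtain ⟨c, hc, h⟩ := hmain
  refine tendsto_atTop_mono' atTop h (Tendsto.const_mul_atTop hc ?_)
  -- Divergence of the ratio reduces to y / log y → ∞, taken at y = log n.
  have h1 : Tendsto (fun y : ℝ => y / Real.log y) atTop atTop := by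
    have h2 : Tendsto (fun y : ℝ => Real.log y / y) atTop (nhdsWithin 0 (Set.Ioi 0)) := by
      refine tendsto_nhdsWithin_iff.2 ⟨Real.isLittleO_log_id_atTop.tendsto_div_nhds_zero, ?_⟩
      filter_upwards [eventually_gt_atTop 1] with y hy
      exact div_pos (Real.log_pos hy) (by linarith)
    refine (tendsto_inv_nhdsGT_zero.comp h2).congr fun y => ?_
    simp
  exact Real.tendsto_sqrt_atTop.comp (h1.comp
    (Real.tendsto_log_atTop.comp tendsto_natCast_atTop_atTop))
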